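/- **Notation.** Let $R$ be a commutative ring. For a ring $R'$, let $\mathcal{B}(R,R')$ be the abelian category of functors $F$ from finitely generated projective $R$-modules to $R'$-modules with $F(0)=0$ (exactness is pointwise), and put $\mathcal{B}(R)=\mathcal{B}(R,R)$. For an $R$-bimodule $M$ let ${\sf I}(M)\in\mathcal{B}(R)$ be the functor $V\mapsto M\otimes_R V$, and let ${\sf I}={\sf I}(R)$ be the tautological functor. An *elementary extension* of $R$ by $M$ is an exact sequence $$0\to {\sf I}(M)\xrightarrow{b} C_1\xrightarrow{d} C_0\xrightarrow{a}{\sf I}\to 0$$ in $\mathcal{B}(R)$; maps of elementary extensions are maps of such sequences that are the identity on ${\sf I}(M)$ and ${\sf I}$. It is *multiplicative* if the complex $C_\bullet=(C_1\to C_0)$, in degrees $1$ and $0$, carries an $R$-linear unit map $R\to C_0(R)$ and functorial maps of complexes $C_\bullet(V)\otimes_R C_\bullet(V')\to C_\bullet(V\otimes_R V')$ that are associative and unital, and $a:C_\bullet\to{\sf I}$ is compatible with units and products. A *square-zero extension* of $R$ by $M$ is a ring $R'$ with a short exact sequence of abelian groups $0\to M\xrightarrow{i}R'\xrightarrow{q}R\to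 0$ such that $q$ is a unital ring map, $i(m)r'=i(m\,q(r'))$, $r'i(m)=i(q(r')m)$ and $i(m)i(m')=0$. Let $q_*({\sf I})\in\mathcal{B}(R,R')$ be the functor sending $V$ to $V$ regarded as an $R'$-module via $q$, and let $q^*:\mathcal{B}(R,R')\to\mathcal{B}(R)$ be $F\mapsto R\otimes_{R'}F(-)$. For a projective resolution $P_\bullet$ of $q_*({\sf I})$ in $\mathcal{B}(R,R')$, the canonical truncation $\tau_{[0,1]}q^*P_\bullet$, given by $\operatorname{Coker}(q^*P_2\to q^*P_1)\to q^*P_0$, is an elementary extension of $R$ by $M$; here $H_0(q^*P_\bullet(V))=R\otimes_{R'}V$ is identified with $V$, and $H_1(q^*P_\bullet(V))=\operatorname{Tor}_1^{R'}(R,V)$ is identified with $M\otimes_R V$ by the connecting map of $0\to M\to R'\to R\to 0$. An elementary extension $\phi$ *corresponds* to $R'$ if such resolutions $P_\bullet$ exist and, for every one of them, $\phi$ and $\tau_{[0,1]}q^*P_\bullet$ are connected by a zigzag of maps of elementary extensions. **Proposition.** Let $R$ be a commutative ring, $M$ an $R$-bimodule, and $R'$ a square-zero extension of $R$ by $M$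 such that the ring $R'$ is commutative. Then $M$ is diagonal, that is, $rm=mr$ for all $r\in R$, $m\in M$, and there is a multiplicative elementary extension $\phi$ of $R$ by $M$ that corresponds to $R'$. -/

import Mathlib

open CategoryTheory TensorProduct

universe u

namespace MacLane

noncomputable section

/-! ### Pointed functors on finitely generated projective modules -/

/-- The property of being a finitely generated projective `R`-module. -/
def isFGProj (R : Type u) [Ring R] : ObjectProperty (ModuleCat.{u} R) :=
  fun V => Module.Finite R V ∧ Module.Projective R V

/-- The category `R-proj` of finitely generated projective left `R`-modules. -/
abbrev RProj (R : Type u) [Ring R] := (isFGProj R).FullSubcategory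

/-- A functor `F : R-proj ⥤ R'-mod` is pointed if `F(0) = 0`. -/
def isPointed (R R' : Type u) [Ring R] [Ring R'] :
    ObjectProperty (RProj R ⥤ ModuleCat.{u} R') :=
  fun F => ∀ V : RProj R, Subsingleton V.obj → Subsingleton (F.obj V)

/-- The category `B(R, R')` of pointed functors from `R-proj` to `R'-mod`. -/
abbrev B (R R' : Type u) [Ring R] [Ring R'] := (isPointed R R').FullSubcategory

/-- The value `F(V)` of a pointed functor. -/
abbrev B.val {R R' : Type u} [Ring R] [Ring R'] (F : B R R') (V : RProj R) : ModuleCat.{u} R' :=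
  F.obj.obj V

/-- The map `F(V) → F(W)` induced by `f : V ⟶ W`. -/
abbrev B.map {R R' : Type u} [Ring R] [Ring R'] (F : B R R') {V W : RProj R} (f : V ⟶ W) :
    F.val V →ₗ[R'] F.val W :=
  (F.obj.map f).hom

/-- The component `F(V) → G(V)` of a morphism of pointed functors. -/
abbrev B.app {R R' : Type u} [Ring R] [Ring R'] {F G : B R R'} (t : F ⟶ G) (V : RProj R) :
    F.val V →ₗ[R'] G.val V :=
  (t.hom.app V).hom

/-! ### The functors attached to bimodules -/

section Bimodule

/-- An `R`-module `V` over the commutative ring `R`, seen as a module over `Rᵐᵒᵖ`. -/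
def OpMod (V : Type u) : Type u := V

instance (V : Type u) [AddCommGroup V] : AddCommGroup (OpMod V) :=
  inferInstanceAs (AddCommGroup V)

instance (R V : Type u) [CommRing R] [AddCommGroup V] [Module R V] : Module Rᵐᵒᵖ (OpMod V) :=
  Module.compHom V ((RingHom.id R).fromOpposite mul_comm)

/-- The map of `Rᵐᵒᵖ`-modules underlying an `R`-linear map. -/
def OpMod.map {R V W : Type u} [CommRing R] [AddCommGroup V] [Module R V]
    [AddCommGroup W] [Module R W] (f : V →ₗ[R] W) : OpMod V →ₗ[Rᵐᵒᵖ] OpMod W where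
  toFun := f
  map_add' := f.map_add
  map_smul' r v := f.map_smul r.unop v

variable (R M : Type u) [CommRing R] [AddCommGroup M] [Module R M] [Module Rᵐᵒᵖ M]

/-- The tensor product `M ⊗_R V` of an `R`-bimodule `M` and an `R`-module `V`: the relations are
`m r ⊗ v = m ⊗ r v`, and `R` acts through the left action on `M`. -/
abbrev BimodTensor (V : Type u) [AddCommGroup V] [Module R V] : Type u :=
  M ⊗[Rᵐᵒᵖ] OpMod V

/-- The pure tensor `m ⊗ v` in `M ⊗_R V`. -/
def btmul {V : Type u} [AddCommGroup V] [Module R V] (m : M) (v : V) : BimodTensor R M V :=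
  TensorProduct.tmul Rᵐᵒᵖ m (show OpMod V from v)

variable [SMulCommClass Rᵐᵒᵖ R M]

/-- The `R`-linear map `M ⊗_R V → M ⊗_R W` induced by `f : V → W`. -/
def BimodTensor.map {V W : Type u} [AddCommGroup V] [Module R V] [AddCommGroup W] [Module R W]
    (f : V →ₗ[R] W) : BimodTensor R M V →ₗ[R] BimodTensor R M W where
  toFun := (OpMod.map f).lTensor M
  map_add' := map_add _
  map_smul' r x := by
    induction x using TensorProduct.induction_on with
    | zero => simp
    | tmul m v => simp [TensorProduct.smul_tmul']
    | add x y hx hy => simp only [smul_add, map_add, hx, hy]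

/-- The functor `I(M) : V ↦ M ⊗_R V` in `B(R, R)` attached to an `R`-bimodule `M`. -/
def bimodFunctor : B R R where
  obj :=
    { obj := fun V => ModuleCat.of R (BimodTensor R M V.obj)
      map := fun f => ModuleCat.ofHom (BimodTensor.map R M f.hom.hom)
      map_id := fun V => by
        apply ModuleCat.hom_ext
        apply LinearMap.ext
        intro x
        exact LinearMap.congr_fun (LinearMap.lTensor_id M (OpMod V.obj) (R := Rᵐᵒᵖ)) x
      map_comp := fun f g => by
        apply ModuleCat.hom_ext
        apply LinearMap.ext
        intro x
        exact LinearMap.congr_fun (LinearMap.lTensor_comp M (OpMod.map g.hom.hom)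
          (OpMod.map f.hom.hom)) x }
  property := fun V hV => by
    refine ⟨fun x y => ?_⟩
    have key : ∀ z : BimodTensor R M V.obj, z = 0 := by
      intro z
      induction z using TensorProduct.induction_on with
      | zero => rfl
      | tmul m v =>
        have : v = 0 := hV.elim v (0 : V.obj)
        rw [this, TensorProduct.tmul_zero]
      | add x y hx hy => rw [hx, hy, add_zero]
    exact (key x).trans (key y).symm

end Bimodule

/-- The tautological functor `I` in `B(R, R)`: the embedding of `R-proj` in `R-mod`. -/
def tautFunctor (R : Type u) [CommRing R] : B R R where
  obj := (isFGProj R).ι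
  property := fun _ hV => hV

/-! ### Elementary extensions -/

/-- An elementary extension of `R` by the `R`-bimodule `M`: an exact sequence
`0 → I(M) → C₁ → C₀ → I → 0` in `B(R, R)` (exactness is computed pointwise). -/
structure ElemExt (R M : Type u) [CommRing R] [AddCommGroup M] [Module R M] [Module Rᵐᵒᵖ M]
    [SMulCommClass Rᵐᵒᵖ R M] where
  C₁ : B R R
  C₀ : B R R
  b : bimodFunctor R M ⟶ C₁
  d : C₁ ⟶ C₀
  a : C₀ ⟶ tautFunctor R
  b_injective : ∀ V, Function.Injective (B.app b V)
  exact₁ : ∀ V, Function.Exact (B.app b V) (B.app d V)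
  exact₀ : ∀ V, Function.Exact (B.app d V) (B.app a V)
  a_surjective : ∀ V, Function.Surjective (B.app a V)

namespace ElemExt

variable {R M : Type u} [CommRing R] [AddCommGroup M] [Module R M] [Module Rᵐᵒᵖ M]
  [SMulCommClass Rᵐᵒᵖ R M]

/-- A map of elementary extensions: a map of complexes that is the identity on `I(M)` and `I`. -/
@[ext]
structure Hom (φ ψ : ElemExt R M) where
  f₁ : φ.C₁ ⟶ ψ.C₁
  f₀ : φ.C₀ ⟶ ψ.C₀
  comm_b : φ.b ≫ f₁ = ψ.b
  comm_d : f₁ ≫ ψ.d = φ.d ≫ f₀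
  comm_a : f₀ ≫ ψ.a = φ.a

/-- The category of elementary extensions of `R` by `M`. -/
instance : Category (ElemExt R M) where
  Hom φ ψ := Hom φ ψ
  id φ := ⟨𝟙 _, 𝟙 _, by simp, by simp, by simp⟩
  comp {φ ψ χ} f g := ⟨f.f₁ ≫ g.f₁, f.f₀ ≫ g.f₀,
    by rw [← Category.assoc, f.comm_b, g.comm_b],
    by rw [Category.assoc, g.comm_d, ← Category.assoc, f.comm_d, Category.assoc],
    by rw [Category.assoc, g.comm_a, f.comm_a]⟩
  id_comp f := Hom.ext (Category.id_comp _) (Category.id_comp _)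
  comp_id f := Hom.ext (Category.comp_id _) (Category.comp_id _)
  assoc f g h := Hom.ext (Category.assoc _ _ _) (Category.assoc _ _ _)

end ElemExt

/-! ### Multiplicative elementary extensions -/

namespace RProj

variable {R : Type u} [CommRing R]

/-- The unit object `R` of `R-proj`. -/
def one (R : Type u) [CommRing R] : RProj R where
  obj := ModuleCat.of R R
  property := ⟨inferInstanceAs (Module.Finite R R), inferInstanceAs (Module.Projective R R)⟩

/-- The tensor product `V ⊗_R W` of finitely generated projective modules. -/
def tensor (V W : RProj R) : RProj R where
  obj := ModuleCat.of R (V.obj ⊗[R] W.obj)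
  property := by
    have := V.property.1
    have := W.property.1
    have := V.property.2
    have := W.property.2
    exact ⟨inferInstanceAs (Module.Finite R (V.obj ⊗[R] W.obj)),
      inferInstanceAs (Module.Projective R (V.obj ⊗[R] W.obj))⟩

/-- The tensor product of two maps. -/
def tensorMap {V V' W W' : RProj R} (f : V ⟶ V') (g : W ⟶ W') : tensor V W ⟶ tensor V' W' :=
  ObjectProperty.homMk (ModuleCat.ofHom (TensorProduct.map f.hom.hom g.hom.hom))

/-- The associativity map `(U ⊗ V) ⊗ W → U ⊗ (V ⊗ W)`. -/
def assoc (U V W : RProj R) : tensor (tensor U V) W ⟶ tensor U (tensor V W) :=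
  ObjectProperty.homMk
    (ModuleCat.ofHom (TensorProduct.assoc R U.obj V.obj W.obj).toLinearMap)

/-- The left unit map `R ⊗ V → V`. -/
def lid (V : RProj R) : tensor (one R) V ⟶ V :=
  ObjectProperty.homMk (ModuleCat.ofHom (TensorProduct.lid R V.obj).toLinearMap)

/-- The right unit map `V ⊗ R → V`. -/
def rid (V : RProj R) : tensor V (one R) ⟶ V :=
  ObjectProperty.homMk (ModuleCat.ofHom (TensorProduct.rid R V.obj).toLinearMap)

end RProj

/-- A multiplicative structure on an elementary extension `φ`: the complex `C₁ → C₀` (in degrees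
`1` and `0`) carries a unit `e : R → C₀(R)` and functorial maps of complexes
`C(V) ⊗_R C(V') → C(V ⊗_R V')` that are associative and unital, and the augmentation `a : C → I`
is multiplicative. The maps are given by their components `C₀ ⊗ C₀ → C₀`, `C₀ ⊗ C₁ → C₁` and
`C₁ ⊗ C₀ → C₁`; the component on `C₁ ⊗ C₁` vanishes because `C₂ = 0`, and so do both sides of any
identity between terms of degree at least `2`. -/
structure MultStructure {R M : Type u} [CommRing R] [AddCommGroup M] [Module R M] [Module Rᵐᵒᵖ M]
    [SMulCommClass Rᵐᵒᵖ R M] (φ : ElemExt R M) where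
  e : R →ₗ[R] φ.C₀.val (RProj.one R)
  m₀₀ : ∀ V V' : RProj R,
    φ.C₀.val V →ₗ[R] φ.C₀.val V' →ₗ[R] φ.C₀.val (RProj.tensor V V')
  m₀₁ : ∀ V V' : RProj R,
    φ.C₀.val V →ₗ[R] φ.C₁.val V' →ₗ[R] φ.C₁.val (RProj.tensor V V')
  m₁₀ : ∀ V V' : RProj R,
    φ.C₁.val V →ₗ[R] φ.C₀.val V' →ₗ[R] φ.C₁.val (RProj.tensor V V')
  -- functoriality
  nat₀₀ : ∀ {V V' W W' : RProj R} (f : V ⟶ W) (g : V' ⟶ W') x y,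
    φ.C₀.map (RProj.tensorMap f g) (m₀₀ V V' x y) = m₀₀ W W' (φ.C₀.map f x) (φ.C₀.map g y)
  nat₀₁ : ∀ {V V' W W' : RProj R} (f : V ⟶ W) (g : V' ⟶ W') x y,
    φ.C₁.map (RProj.tensorMap f g) (m₀₁ V V' x y) = m₀₁ W W' (φ.C₀.map f x) (φ.C₁.map g y)
  nat₁₀ : ∀ {V V' W W' : RProj R} (f : V ⟶ W) (g : V' ⟶ W') x y,
    φ.C₁.map (RProj.tensorMap f g) (m₁₀ V V' x y) = m₁₀ W W' (φ.C₁.map f x) (φ.C₀.map g y)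
  -- compatibility with the differentials (Leibniz rule)
  d_m₀₁ : ∀ V V' x y, B.app φ.d _ (m₀₁ V V' x y) = m₀₀ V V' x (B.app φ.d V' y)
  d_m₁₀ : ∀ V V' x y, B.app φ.d _ (m₁₀ V V' x y) = m₀₀ V V' (B.app φ.d V x) y
  d_m₁₁ : ∀ V V' x y, m₀₁ V V' (B.app φ.d V x) y = m₁₀ V V' x (B.app φ.d V' y)
  -- associativity
  assoc₀₀₀ : ∀ U V W x y z, φ.C₀.map (RProj.assoc U V W) (m₀₀ _ W (m₀₀ U V x y) z) =
    m₀₀ U _ x (m₀₀ V W y z)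
  assoc₁₀₀ : ∀ U V W x y z, φ.C₁.map (RProj.assoc U V W) (m₁₀ _ W (m₁₀ U V x y) z) =
    m₁₀ U _ x (m₀₀ V W y z)
  assoc₀₁₀ : ∀ U V W x y z, φ.C₁.map (RProj.assoc U V W) (m₁₀ _ W (m₀₁ U V x y) z) =
    m₀₁ U _ x (m₁₀ V W y z)
  assoc₀₀₁ : ∀ U V W x y z, φ.C₁.map (RProj.assoc U V W) (m₀₁ _ W (m₀₀ U V x y) z) =
    m₀₁ U _ x (m₀₁ V W y z)
  -- unitality
  e_m₀₀ : ∀ V r x, φ.C₀.map (RProj.lid V) (m₀₀ _ V (e r) x) = r • x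
  e_m₀₁ : ∀ V r x, φ.C₁.map (RProj.lid V) (m₀₁ _ V (e r) x) = r • x
  m₀₀_e : ∀ V x r, φ.C₀.map (RProj.rid V) (m₀₀ V _ x (e r)) = r • x
  m₁₀_e : ∀ V x r, φ.C₁.map (RProj.rid V) (m₁₀ V _ x (e r)) = r • x
  -- multiplicativity of the augmentation
  a_e : ∀ r : R, B.app φ.a (RProj.one R) (e r) = (show R from r)
  a_m₀₀ : ∀ V V' x y, B.app φ.a (RProj.tensor V V') (m₀₀ V V' x y) =
    (show V.obj from B.app φ.a V x) ⊗ₜ[R] (show V'.obj from B.app φ.a V' y)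

/-! ### Square-zero extensions and the associated elementary extensions -/

/-- The structure on `R'` of a square-zero extension of the ring `R` by the `R`-bimodule `M`. -/
structure SquareZeroExt (R M R' : Type u) [Ring R] [Ring R'] [AddCommGroup M] [Module R M]
    [Module Rᵐᵒᵖ M] where
  i : M →+ R'
  q : R' →+* R
  i_injective : Function.Injective i
  exact : Function.Exact i q
  q_surjective : Function.Surjective q
  i_mul : ∀ m r, i m * r = i (MulOpposite.op (q r) • m)
  mul_i : ∀ r m, r * i m = i (q r • m)
  i_mul_i : ∀ m m', i m * i m' = 0

section Correspondence

variable {R R' : Type u} [CommRing R] [CommRing R']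

/-- The object `q_*(I)` of `B(R, R')`: the functor that sends `V` to `V` seen as an `R'`-module. -/
def qPushTaut (q : R' →+* R) : B R R' where
  obj := (isFGProj R).ι ⋙ ModuleCat.restrictScalars q
  property := fun _ hV => hV

/-- The functor `q^* : B(R, R') ⥤ B(R, R)`, `(q^* F)(V) = R ⊗_{R'} F(V)`. -/
def qPull (q : R' →+* R) : B R R' ⥤ B R R :=
  (isPointed R R).lift
    ((isPointed R R').ι ⋙ (Functor.whiskeringRight _ _ _).obj (ModuleCat.extendScalars.{u, u, u} q))
    (fun F V hV => by
      have hF : Limits.IsZero (F.obj.obj V) := by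
        have := F.property V hV
        exact ModuleCat.isZero_of_subsingleton _
      exact ModuleCat.subsingleton_of_isZero
        ((ModuleCat.extendScalars.{u, u, u} q).map_isZero hF))

/-- The canonical map `F(V) → R ⊗_{R'} F(V)`, `x ↦ 1 ⊗ x`. -/
def qUnit (q : R' →+* R) (F : B R R') (V : RProj R) (x : F.val V) : ((qPull q).obj F).val V :=
  ((ModuleCat.extendRestrictScalarsAdj.{u, u, u} q).unit.app (F.val V)).hom x

/-- A projective resolution of an object `X` of `B(R, R')` (exactness is computed pointwise). -/
structure ProjRes (X : B R R') where
  P : ChainComplex (B R R') ℕ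
  projective : ∀ n, Projective (P.X n)
  aug : P.X 0 ⟶ X
  aug_surjective : ∀ V, Function.Surjective (B.app aug V)
  exact_zero : ∀ V, Function.Exact (B.app (P.d 1 0) V) (B.app aug V)
  exact_succ : ∀ n V, Function.Exact (B.app (P.d (n + 2) (n + 1)) V) (B.app (P.d (n + 1) n) V)

variable {M : Type u} [AddCommGroup M] [Module R M] [Module Rᵐᵒᵖ M] [SMulCommClass Rᵐᵒᵖ R M]

/-- An identification of the elementary extension `ψ` with the canonical truncation
`τ_{[0,1]} q^* P` of `q^* P`, for a projective resolution `P` of `q_*(I)`. The truncation has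
`q^* P₀` in degree `0` and the cokernel of `q^* P₂ → q^* P₁` in degree `1`; its `0`-th homology is
identified with `I` by the adjoint of the augmentation, and its first homology
`V ↦ L¹q^* (q_* V) = Tor₁^{R'}(R, q_* V)` is identified with `M ⊗_R V` by the connecting map of
`0 → M → R' → R → 0`. Explicitly, that map takes the class of `1 ⊗ w` with `w ∈ P₁(V)` and
`dw = i(m) p`, `p ∈ P₀(V)`, to `m ⊗ v`, where `v` is the image of `p` in `V`. -/
structure TruncationIso (E : SquareZeroExt R M R') (P : ProjRes (qPushTaut E.q))
    (ψ : ElemExt R M) where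
  t₀ : (qPull E.q).obj (P.P.X 0) ≅ ψ.C₀
  t₁ : (qPull E.q).obj (P.P.X 1) ⟶ ψ.C₁
  t₁_surjective : ∀ V, Function.Surjective (B.app t₁ V)
  t₁_exact : ∀ V, Function.Exact (B.app ((qPull E.q).map (P.P.d 2 1)) V) (B.app t₁ V)
  comm_d : t₁ ≫ ψ.d = (qPull E.q).map (P.P.d 1 0) ≫ t₀.hom
  comm_a : ∀ V (p : (P.P.X 0).val V),
    (show V.obj from B.app ψ.a V (B.app t₀.hom V (qUnit E.q _ V p))) = B.app P.aug V p
  comm_b : ∀ V (m : M) (p : (P.P.X 0).val V) (w : (P.P.X 1).val V),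
    B.app (P.P.d 1 0) V w = E.i m • p →
    B.app ψ.b V (btmul R M m (show V.obj from B.app P.aug V p)) = B.app t₁ V (qUnit E.q _ V w)

/-- The elementary extension `φ` corresponds to the square-zero extension `E`: the object `q_*(I)`
has projective resolutions in `B(R, R')`, and for every such resolution `P` the truncation
`τ_{[0,1]} q^* P` is an elementary extension of `R` by `M` that lies in the same connected component
of the category of elementary extensions as `φ`. -/
def CorrespondsTo (E : SquareZeroExt R M R') (φ : ElemExt R M) : Prop :=
  Nonempty (ProjRes (qPushTaut E.q)) ∧
    ∀ P : ProjRes (qPushTaut E.q),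
      ∃ ψ : ElemExt R M, Nonempty (TruncationIso E P ψ) ∧ Zigzag φ ψ

end Correspondence

end

end MacLane

/-! Write J for the kernel of q. Diagonality comes from commuting i(m) past lifts of elements of R.
For the extension, the point is that `q_*(I)` has a cover which is at once projective and
multiplicative: Q(V) = R'[V]/R'[0], with product [v]·[w] = [v ⊗ w], unit [1] and augmentation [v] ↦
v. The augmentation respects products, so its kernel K is a two-sided ideal. Applying R ⊗_{R'} - to
K → Q therefore gives a complex with all the required products, and the identities between them are
inherited from Q.

Exactness is a Tor computation made explicit. Since q is onto, R ⊗_{R'} F(V) is F(V)/J·F(V)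
(`qη_surjective`, `qη_eq_zero_iff`). As J kills V, JQ lies in K, and the kernel of K/JK → Q/JQ is
JQ/JK. When Q(V) is flat, J ⊗ Q(V) ≅ JQ(V), so JQ/JK is J ⊗_{R'} V ≅ M ⊗_R V; the isomorphism is the
connecting map m ⊗ aug(x) ↦ [i(m)x] (`connHom_injective`, `exact_connHom`). This works for every
pointwise flat Q with a surjection onto `q_*(I)`, and maps of such Q over `q_*(I)` induce maps of
elementary extensions (`trunc`, `truncMap`).

For a projective resolution P, right exactness of R ⊗_{R'} - identifies the truncation of `q^* P`
with the extension attached to P₀ → `q_*(I)` (`truncationIso`); P₀ is pointwise projective, hence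
flat, being a retract of a sum of reduced representables (`projective_val`). Finally Q is the
reduced linearization of the functor represented by R, so by Yoneda a lift of 1 ∈ R to P₀(R) is a
map Q → P₀ over `q_*(I)`. A single map of elementary extensions thus joins the multiplicative one to
the truncation of any P. -/

namespace MacLane

noncomputable section

/-! ### Morphisms of pointed functors -/

section Basic

variable {R R' : Type u} [Ring R] [Ring R']

/-- A morphism of pointed functors, from a natural family of linear maps. -/
def B.mkHom {F G : B R R'} (t : ∀ V, F.val V →ₗ[R'] G.val V)
    (ht : ∀ {V W : RProj R} (f : V ⟶ W) x, t W (F.map f x) = G.map f (t V x)) : F ⟶ G :=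
  ObjectProperty.homMk
    { app := fun V => ModuleCat.ofHom (t V)
      naturality := fun _ _ f => ModuleCat.hom_ext (LinearMap.ext fun x => ht f x) }

theorem B.hom_ext {F G : B R R'} {s t : F ⟶ G} (h : ∀ V x, B.app s V x = B.app t V x) : s = t := by
  apply ObjectProperty.hom_ext
  apply NatTrans.ext
  funext V
  exact ModuleCat.hom_ext (LinearMap.ext (h V))

@[simp]
theorem B.app_comp {F G H : B R R'} (s : F ⟶ G) (t : G ⟶ H) (V : RProj R) (x : F.val V) :
    B.app (s ≫ t) V x = B.app t V (B.app s V x) :=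
  rfl

@[simp]
theorem B.app_zero (F G : B R R') (V : RProj R) (x : F.val V) : B.app (0 : F ⟶ G) V x = 0 :=
  rfl

theorem B.map_comp (F : B R R') {U V W : RProj R} (f : U ⟶ V) (g : V ⟶ W) (x : F.val U) :
    F.map (f ≫ g) x = F.map g (F.map f x) := by
  simp [B.map]

@[simp]
theorem B.map_id (F : B R R') (V : RProj R) (x : F.val V) : F.map (𝟙 V) x = x := by
  simp [B.map]

theorem B.app_map {F G : B R R'} (t : F ⟶ G) {V W : RProj R} (f : V ⟶ W) (x : F.val V) :
    B.app t W (F.map f x) = G.map f (B.app t V x) :=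
  LinearMap.congr_fun (congrArg ModuleCat.Hom.hom (t.hom.naturality f)) x

/-- Pointed functors kill zero maps. -/
theorem B.map_zero_apply (F : B R R') (V W : RProj R) (x : F.val V) :
    F.map (0 : V ⟶ W) x = 0 := by
  let Z : RProj R := ⟨ModuleCat.of R PUnit, inferInstanceAs (Module.Finite R PUnit.{u + 1}),
    inferInstanceAs (Module.Projective R PUnit.{u + 1})⟩
  have hZ : Subsingleton (F.val Z) := F.property Z (inferInstanceAs (Subsingleton PUnit.{u + 1}))
  have h : (0 : V ⟶ W) = (0 : V ⟶ Z) ≫ (0 : Z ⟶ W) := by simp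
  rw [h, B.map_comp, hZ.elim (F.map _ x) 0, map_zero]

/-- The kernel of a morphism of pointed functors. -/
def B.ker {F G : B R R'} (t : F ⟶ G) : B R R' where
  obj :=
    { obj := fun V => ModuleCat.of R' (LinearMap.ker (B.app t V))
      map := fun {V W} f => ModuleCat.ofHom ((F.map f).restrict fun x hx => by
        rw [LinearMap.mem_ker] at hx ⊢
        rw [B.app_map, hx, map_zero])
      map_id := fun V => ModuleCat.hom_ext (LinearMap.ext fun x => Subtype.ext (F.map_id V x.1))
      map_comp := fun f g =>
        ModuleCat.hom_ext (LinearMap.ext fun x => Subtype.ext (F.map_comp f g x.1)) }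
  property := fun V hV =>
    ⟨fun x y => Subtype.ext ((F.property V hV).elim x.1 y.1)⟩

/-- An element of the kernel. -/
def B.ker.mk {F G : B R R'} (t : F ⟶ G) {V : RProj R} (x : F.val V) (hx : B.app t V x = 0) :
    (B.ker t).val V :=
  ⟨x, hx⟩

/-- The inclusion of the kernel. -/
def B.kerι {F G : B R R'} (t : F ⟶ G) : B.ker t ⟶ F :=
  B.mkHom (fun V => (LinearMap.ker (B.app t V)).subtype) fun _ _ => rfl

theorem B.app_kerι_injective {F G : B R R'} (t : F ⟶ G) (V : RProj R) :
    Function.Injective (B.app (B.kerι t) V) :=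
  Subtype.val_injective

theorem B.app_app_kerι {F G : B R R'} (t : F ⟶ G) (V : RProj R) (x : (B.ker t).val V) :
    B.app t V (B.app (B.kerι t) V x) = 0 :=
  x.2

/-- A morphism into the kernel. -/
def B.kerLift {E F G : B R R'} (t : F ⟶ G) (s : E ⟶ F) (h : ∀ V x, B.app t V (B.app s V x) = 0) :
    E ⟶ B.ker t :=
  B.mkHom (fun V => (B.app s V).codRestrict _ (h V))
    fun f x => Subtype.ext (B.app_map s f x)

@[simp]
theorem B.app_kerι_kerLift {E F G : B R R'} (t : F ⟶ G) (s : E ⟶ F)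
    (h : ∀ V x, B.app t V (B.app s V x) = 0) (V : RProj R) (x : E.val V) :
    B.app (B.kerι t) V (B.app (B.kerLift t s h) V x) = B.app s V x :=
  rfl

/-- The cokernel of a morphism of pointed functors. -/
def B.coker {F G : B R R'} (t : F ⟶ G) : B R R' where
  obj :=
    { obj := fun V => ModuleCat.of R' (G.val V ⧸ LinearMap.range (B.app t V))
      map := fun {V W} f => ModuleCat.ofHom (Submodule.mapQ _ _ (G.map f) (by
        rintro _ ⟨x, rfl⟩
        exact ⟨F.map f x, B.app_map t f x⟩))
      map_id := fun V => by
        apply ModuleCat.hom_ext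
        apply Submodule.linearMap_qext
        exact LinearMap.ext fun x => congrArg (Submodule.Quotient.mk) (G.map_id V x)
      map_comp := fun f g => by
        apply ModuleCat.hom_ext
        apply Submodule.linearMap_qext
        exact LinearMap.ext fun x => congrArg (Submodule.Quotient.mk) (G.map_comp f g x) }
  property := fun V hV => by
    have := G.property V hV
    exact inferInstanceAs (Subsingleton (G.val V ⧸ LinearMap.range (B.app t V)))

/-- The projection to the cokernel. -/
def B.cokerπ {F G : B R R'} (t : F ⟶ G) : G ⟶ B.coker t :=
  B.mkHom (fun V => (LinearMap.range (B.app t V)).mkQ) fun _ _ => rfl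

/-- The pointwise cokernel is again a pointed functor, so its projection can be cancelled against 0.
This turns categorical projectivity into lifting of individual elements. -/
theorem B.surjective_of_epi {F G : B R R'} (t : F ⟶ G) [Epi t] (V : RProj R) :
    Function.Surjective (B.app t V) := by
  have h : t ≫ B.cokerπ t = t ≫ 0 :=
    B.hom_ext fun V x => (Submodule.Quotient.mk_eq_zero _).2 ⟨x, rfl⟩
  intro y
  have hy : B.app (B.cokerπ t) V y = 0 := by
    rw [(cancel_epi t).1 h]
    rfl
  exact (Submodule.Quotient.mk_eq_zero _).1 hy

theorem B.epi_of_surjective {F G : B R R'} (t : F ⟶ G)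
    (h : ∀ V, Function.Surjective (B.app t V)) : Epi t where
  left_cancellation r s hrs := B.hom_ext fun V x => by
    obtain ⟨y, rfl⟩ := h V x
    rw [← B.app_comp, hrs, B.app_comp]

end Basic

/-! ### Semilinear maps along surjections -/

section Descend

variable {R R' : Type*} [CommRing R] [CommRing R'] {q : R' →+* R}
  {A C L : Type*} [AddCommGroup A] [Module R' A] [AddCommGroup C] [Module R C]
  [AddCommGroup L] [Module R L]

/-- The linear map induced on the target of a surjective semilinear map. -/
def descend (hq : Function.Surjective q) (η : A →ₛₗ[q] C) (hη : Function.Surjective η)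
    (g : A →ₛₗ[q] L) (h : ∀ x, η x = 0 → g x = 0) : C →ₗ[R] L :=
  have key : ∀ x, g (Function.surjInv hη (η x)) = g x := fun x => by
    rw [← sub_eq_zero, ← map_sub]
    apply h
    rw [map_sub, Function.surjInv_eq hη, sub_self]
  { toFun := fun y => g (Function.surjInv hη y)
    map_add' := fun x y => by
      obtain ⟨x, rfl⟩ := hη x
      obtain ⟨y, rfl⟩ := hη y
      rw [← map_add, key, key, key, map_add]
    map_smul' := fun r x => by
      obtain ⟨x, rfl⟩ := hη x
      obtain ⟨r, rfl⟩ := hq r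
      rw [← map_smulₛₗ, key, key, map_smulₛₗ, RingHom.id_apply] }

@[simp]
theorem descend_apply (hq : Function.Surjective q) (η : A →ₛₗ[q] C) (hη : Function.Surjective η)
    (g : A →ₛₗ[q] L) (h : ∀ x, η x = 0 → g x = 0) (x : A) : descend hq η hη g h (η x) = g x := by
  change g (Function.surjInv hη (η x)) = g x
  rw [← sub_eq_zero, ← map_sub]
  apply h
  rw [map_sub, Function.surjInv_eq hη, sub_self]

end Descend

/-! ### The unit `F(V) → R ⊗_{R'} F(V)` -/

section QUnit

variable {R R' : Type u} [CommRing R] [CommRing R'] (q : R' →+* R)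

/-- The canonical map `F(V) → R ⊗_{R'} F(V)` as a semilinear map. -/
def qη (F : B R R') (V : RProj R) : F.val V →ₛₗ[q] ((qPull q).obj F).val V where
  toFun := qUnit q F V
  map_add' := map_add _
  map_smul' r x := map_smul ((ModuleCat.extendRestrictScalarsAdj.{u, u, u} q).unit.app _).hom r x

theorem qη_app {F G : B R R'} (t : F ⟶ G) (V : RProj R) (x : F.val V) :
    B.app ((qPull q).map t) V (qη q F V x) = qη q G V (B.app t V x) :=
  rfl

theorem qη_map (F : B R R') {V W : RProj R} (f : V ⟶ W) (x : F.val V) :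
    ((qPull q).obj F).map f (qη q F V x) = qη q F W (F.map f x) :=
  rfl

variable {q}

/-- Since q is onto, q(r) ⊗ x = 1 ⊗ r x. Later statements about R ⊗_{R'} F(V) are all checked on
classes of elements of F(V). -/
theorem qη_surjective (hq : Function.Surjective q) (F : B R R') (V : RProj R) :
    Function.Surjective (qη q F V) := by
  intro y
  let _ : Module R' R :=
    (inferInstance : Module R' ((ModuleCat.restrictScalars q).obj (ModuleCat.of R R)))
  have key : ∀ y : R ⊗[R'] (F.val V), ∃ x, (1 : R) ⊗ₜ[R'] x = y := by
    intro y
    induction y using TensorProduct.induction_on with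
    | zero => exact ⟨0, tmul_zero _ _⟩
    | tmul r x =>
      obtain ⟨r, rfl⟩ := hq r
      refine ⟨r • x, ?_⟩
      rw [tmul_smul, smul_tmul']
      congr 1
      exact mul_one (q r)
    | add x y hx hy =>
      obtain ⟨x, rfl⟩ := hx
      obtain ⟨y, rfl⟩ := hy
      exact ⟨x + y, tmul_add _ _ _⟩
  exact key y

/-- Right exactness of the tensor product, applied to Ker q → R' → R: if 1 ⊗ x dies in R ⊗ F(V),
then 1 ⊗ x in R' ⊗ F(V) comes from Ker q ⊗ F(V), and multiplying out recovers x. With surjectivity,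
R ⊗_{R'} F(V) becomes the quotient of F(V) by Ker q · F(V). -/
theorem qη_eq_zero_iff (hq : Function.Surjective q) {F : B R R'} {V : RProj R} (x : F.val V) :
    qη q F V x = 0 ↔ x ∈ RingHom.ker q • (⊤ : Submodule R' (F.val V)) := by
  constructor
  · intro h
    let _ : Module R' R :=
      (inferInstance : Module R' ((ModuleCat.restrictScalars q).obj (ModuleCat.of R R)))
    let q' : R' →ₗ[R'] R :=
      { toFun := q, map_add' := map_add q, map_smul' := map_mul q }
    have hex : Function.Exact (RingHom.ker q).subtype q' := fun r =>
      ⟨fun hr => ⟨⟨r, hr⟩, rfl⟩, fun ⟨s, hs⟩ => hs ▸ s.2⟩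
    have h1 : q'.rTensor (F.val V) ((1 : R') ⊗ₜ[R'] x) = 0 := by
      rw [LinearMap.rTensor_tmul]
      change q 1 ⊗ₜ[R'] x = 0
      rw [map_one]
      exact h
    obtain ⟨y, hy⟩ := (rTensor_exact (F.val V) hex hq _).1 h1
    have h2 : x = TensorProduct.lid R' (F.val V) ((RingHom.ker q).subtype.rTensor _ y) := by
      rw [hy, lid_tmul, one_smul]
    rw [h2]
    clear hy h2
    induction y using TensorProduct.induction_on with
    | zero => simp
    | tmul r z => simpa using Submodule.smul_mem_smul r.2 Submodule.mem_top
    | add y z hy hz => simpa using add_mem hy hz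
  · intro h
    refine Submodule.smul_induction_on h (fun r hr y _ => ?_) (fun y z hy hz => ?_)
    · rw [map_smulₛₗ, (hr : q r = 0), zero_smul]
    · rw [map_add, hy, hz, add_zero]

end QUnit

/-! ### Reduced linearizations of set-valued functors -/

section Lin

variable {R : Type u} (R' : Type u) [CommRing R] [CommRing R'] (S : RProj R ⥤ Type u)

theorem map_zero_map {V W : RProj R} (f : V ⟶ W) (s : S.obj V) :
    S.map (0 : W ⟶ W) (S.map f s) = S.map f (S.map (0 : V ⟶ V) s) := by
  rw [← Functor.map_comp_apply, ← Functor.map_comp_apply]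
  simp

theorem map_zero_map_zero {V : RProj R} (s : S.obj V) :
    S.map (0 : V ⟶ V) (S.map (0 : V ⟶ V) s) = S.map (0 : V ⟶ V) s := by
  rw [← Functor.map_comp_apply]
  simp

/-- The span of the base points in the free module on `S(V)`. -/
def basepoints (V : RProj R) : Submodule R' (S.obj V →₀ R') :=
  Submodule.span R' (Set.range fun s => Finsupp.single (S.map (0 : V ⟶ V) s) 1)

/-- The pointed functor `V ↦ R'[S(V)] / R'[S(0)]`, left adjoint to the forgetful functor. -/
def lin : B R R' where
  obj :=
    { obj := fun V => ModuleCat.of R' ((S.obj V →₀ R') ⧸ basepoints R' S V)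
      map := fun {V W} f => ModuleCat.ofHom
        (Submodule.mapQ _ _ (Finsupp.lmapDomain R' R' (S.map f)) (by
          rw [basepoints, Submodule.span_le]
          rintro _ ⟨s, rfl⟩
          simp only [SetLike.mem_coe, Submodule.mem_comap, Finsupp.lmapDomain_apply,
            Finsupp.mapDomain_single]
          exact Submodule.subset_span ⟨S.map f s, by rw [← map_zero_map]⟩))
      map_id := fun V => by
        apply ModuleCat.hom_ext
        apply Submodule.linearMap_qext
        apply Finsupp.lhom_ext'
        intro s
        apply LinearMap.ext_ring
        simp
      map_comp := fun f g => by
        apply ModuleCat.hom_ext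
        apply Submodule.linearMap_qext
        apply Finsupp.lhom_ext'
        intro s
        apply LinearMap.ext_ring
        simp }
  property := fun V hV => by
    refine Submodule.Quotient.subsingleton_iff.2 (eq_top_iff.2 fun x _ => ?_)
    -- On a zero module the identity is the zero map, so every generator is a base point.
    have h : (0 : V ⟶ V) = 𝟙 V :=
      ObjectProperty.hom_ext _ (ModuleCat.hom_ext (LinearMap.ext fun _ => hV.elim _ _))
    induction x using Finsupp.induction_linear with
    | zero => exact zero_mem _
    | add x y hx hy => exact add_mem (hx trivial) (hy trivial)
    | single s r =>
      rw [← mul_one r, ← smul_eq_mul, ← Finsupp.smul_single]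
      exact Submodule.smul_mem _ _ (Submodule.subset_span ⟨s, by rw [h]; simp⟩)

variable {R' S}

/-- The projection from the free module. -/
def lin.mk (V : RProj R) : (S.obj V →₀ R') →ₗ[R'] (lin R' S).val V :=
  (basepoints R' S V).mkQ

/-- The generator `[s]`. -/
def lin.of {V : RProj R} (s : S.obj V) : (lin R' S).val V :=
  lin.mk V (Finsupp.single s 1)

@[simp]
theorem lin.map_of {V W : RProj R} (f : V ⟶ W) (s : S.obj V) :
    (lin R' S).map f (lin.of s) = lin.of (S.map f s) := by
  exact congrArg (lin.mk W) Finsupp.mapDomain_single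

/-- The linear map with prescribed values on the generators. -/
def lin.desc {V : RProj R} {N : Type*} [AddCommGroup N] [Module R' N] (g : S.obj V → N)
    (hg : ∀ s, g (S.map (0 : V ⟶ V) s) = 0) : (lin R' S).val V →ₗ[R'] N :=
  Submodule.liftQ _ (Finsupp.linearCombination R' g) (by
    rw [basepoints, Submodule.span_le]
    rintro _ ⟨s, rfl⟩
    simpa using hg s)

@[simp]
theorem lin.desc_of {V : RProj R} {N : Type*} [AddCommGroup N] [Module R' N] (g : S.obj V → N)
    (hg : ∀ s, g (S.map (0 : V ⟶ V) s) = 0) (s : S.obj V) : lin.desc (R' := R') g hg (lin.of s) = g s := by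
  exact (Finsupp.linearCombination_single R' 1 s).trans (one_smul _ _)

theorem lin.hom_ext {V : RProj R} {N : Type*} [AddCommGroup N] [Module R' N]
    {g h : (lin R' S).val V →ₗ[R'] N} (H : ∀ s, g (lin.of s) = h (lin.of s)) : g = h := by
  apply Submodule.linearMap_qext
  apply Finsupp.lhom_ext'
  intro s
  apply LinearMap.ext_ring
  exact H s

theorem lin.induction {V : RProj R} {p : (lin R' S).val V → Prop} (x : (lin R' S).val V)
    (zero : p 0) (of : ∀ s, p (lin.of s)) (add : ∀ x y, p x → p y → p (x + y))
    (smul : ∀ (r : R') x, p x → p (r • x)) : p x := by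
  obtain ⟨f, rfl⟩ : ∃ f, lin.mk V f = x := Submodule.mkQ_surjective _ x
  induction f using Finsupp.induction_linear with
  | zero => rwa [map_zero]
  | add f g hf hg => rw [map_add]; exact add _ _ hf hg
  | single s r =>
    rw [← mul_one r, ← smul_eq_mul, ← Finsupp.smul_single, map_smul]
    exact smul _ _ (of s)

theorem lin.of_basepoint {V : RProj R} (s : S.obj V) :
    (lin.of (S.map (0 : V ⟶ V) s) : (lin R' S).val V) = 0 :=
  (Submodule.Quotient.mk_eq_zero _).2 (Submodule.subset_span ⟨s, rfl⟩)

/-- Passing to the quotient by the base points is split by [s] ↦ [s] − [base point of s], so the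
value is a direct summand of a free module. -/
instance lin.projective (V : RProj R) : Module.Projective R' ((lin R' S).val V) :=
  Module.Projective.of_split (M := S.obj V →₀ R')
    (lin.desc (fun s => Finsupp.single s 1 - Finsupp.single (S.map (0 : V ⟶ V) s) 1)
      fun s => by rw [map_zero_map_zero, sub_self])
    (lin.mk V)
    (lin.hom_ext fun s => by
      rw [LinearMap.comp_apply, lin.desc_of, map_sub]
      exact (congrArg (_ - ·) (lin.of_basepoint s)).trans (sub_zero _))

/-- The morphism of pointed functors with prescribed values on the generators. -/
def lin.descHom {F : B R R'} (g : ∀ V, S.obj V → F.val V)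
    (hg : ∀ {V W : RProj R} (f : V ⟶ W) s, g W (S.map f s) = F.map f (g V s)) : lin R' S ⟶ F :=
  B.mkHom (fun V => lin.desc (g V) fun s => by rw [hg, B.map_zero_apply])
    fun {V W} f x => by
      have hW : ∀ s, g W (S.map (0 : W ⟶ W) s) = 0 := fun s => by rw [hg, B.map_zero_apply]
      have hV : ∀ s, g V (S.map (0 : V ⟶ V) s) = 0 := fun s => by rw [hg, B.map_zero_apply]
      have key : (lin.desc (g W) hW).comp ((lin R' S).map f) = (F.map f).comp (lin.desc (g V) hV) :=
        lin.hom_ext fun s => by simp [hg]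
      exact LinearMap.congr_fun key x

@[simp]
theorem lin.descHom_of {F : B R R'} (g : ∀ V, S.obj V → F.val V)
    (hg : ∀ {V W : RProj R} (f : V ⟶ W) s, g W (S.map f s) = F.map f (g V s)) (V : RProj R)
    (s : S.obj V) : B.app (lin.descHom g hg) V (lin.of s) = g V s :=
  lin.desc_of (g V) (fun s => by rw [hg, B.map_zero_apply]) s

theorem lin.app_ext {F : B R R'} {s t : lin R' S ⟶ F}
    (h : ∀ V x, B.app s V (lin.of x) = B.app t V (lin.of x)) : s = t :=
  B.hom_ext fun V => LinearMap.congr_fun (lin.hom_ext (h V))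

end Lin

/-! ### Projective covers and resolutions -/

section Cover

variable {R R' : Type u} [CommRing R] [CommRing R']

/-- The disjoint union of the functors represented by a family of objects. -/
def sumRep {T : Type u} (W : T → RProj R) : RProj R ⥤ Type u where
  obj V := Σ t, (W t ⟶ V)
  map f := ↾ fun x => ⟨x.1, x.2 ≫ f⟩

/-- The element of the disjoint union given by an element of one summand. -/
def sumRep.mk {T : Type u} {W : T → RProj R} {V : RProj R} (t : T) (f : W t ⟶ V) :
    (sumRep W).obj V :=
  (⟨t, f⟩ : Σ t, (W t ⟶ V))

theorem sumRep_map_mk {T : Type u} {W : T → RProj R} {V V' : RProj R} (f : V ⟶ V') (t : T)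
    (g : W t ⟶ V) : (sumRep W).map f (sumRep.mk t g) = sumRep.mk t (g ≫ f) :=
  rfl

/-- The map out of the disjoint union given by values on the universal elements. -/
def sumRep.eval {T : Type u} {W : T → RProj R} {F : B R R'} (y : ∀ t, F.val (W t)) (V : RProj R)
    (x : Σ t, (W t ⟶ V)) : F.val V :=
  F.map x.2 (y x.1)

theorem sumRep.eval_map {T : Type u} {W : T → RProj R} {F : B R R'} (y : ∀ t, F.val (W t))
    {V V' : RProj R} (f : V ⟶ V') (x : (sumRep W).obj V) :
    sumRep.eval y V' ((sumRep W).map f x) = F.map f (sumRep.eval y V x) :=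
  F.map_comp x.2 f _

/-- The morphism of pointed functors with prescribed values on the universal elements. -/
def sumRep.desc {T : Type u} {W : T → RProj R} {F : B R R'} (y : ∀ t, F.val (W t)) :
    lin R' (sumRep W) ⟶ F :=
  lin.descHom (sumRep.eval y) (sumRep.eval_map y)

theorem sumRep.desc_of {T : Type u} {W : T → RProj R} {F : B R R'} (y : ∀ t, F.val (W t))
    {V : RProj R} (t : T) (f : W t ⟶ V) :
    B.app (sumRep.desc y) V (lin.of (sumRep.mk t f)) = F.map f (y t) :=
  lin.descHom_of _ (sumRep.eval_map y) _ _

/-- Yoneda: a morphism out of this functor is a free choice of images of the universal elements, and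
those images lift one at a time along a pointwise surjection. -/
instance projective_lin_sumRep {T : Type u} (W : T → RProj R) :
    Projective (lin R' (sumRep W)) where
  factors {E X} f e _ := by
    choose y hy using fun t => B.surjective_of_epi e (W t)
      (B.app f (W t) (lin.of (sumRep.mk t (𝟙 _))))
    refine ⟨sumRep.desc y, lin.app_ext ?_⟩
    rintro V ⟨t, g⟩
    change B.app _ V (lin.of (sumRep.mk t g)) = B.app f V (lin.of (sumRep.mk t g))
    rw [B.app_comp, sumRep.desc_of, B.app_map, hy, ← B.app_map, lin.map_of, sumRep_map_mk,
      Category.id_comp]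

/-- The finite free module `Rⁿ`. -/
def RProj.free (R : Type u) [CommRing R] (n : ℕ) : RProj R where
  obj := ModuleCat.of R (Fin n → R)
  property := ⟨inferInstanceAs (Module.Finite R (Fin n → R)),
    inferInstanceAs (Module.Projective R (Fin n → R))⟩

/-- This lets covers be indexed by elements of F(Rⁿ) alone, a set in the universe `u`, although the
objects of `RProj R` form a larger type. -/
theorem RProj.exists_retract (V : RProj R) :
    ∃ (n : ℕ) (s : V ⟶ RProj.free R n) (r : RProj.free R n ⟶ V), s ≫ r = 𝟙 V := by
  have := V.property.1
  have := V.property.2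
  obtain ⟨n, r, s, -, -, h⟩ := Module.Finite.exists_comp_eq_id_of_projective R V.obj
  refine ⟨n, ObjectProperty.homMk (ModuleCat.ofHom s), ObjectProperty.homMk (ModuleCat.ofHom r), ?_⟩
  apply ObjectProperty.hom_ext
  exact ModuleCat.hom_ext h

/-- The projective cover of a pointed functor by representable functors. -/
def cover (F : B R R') : B R R' :=
  lin R' (sumRep fun t : Σ n, F.val (RProj.free R n) => RProj.free R t.1)

instance (F : B R R') : Projective (cover F) :=
  projective_lin_sumRep _

/-- The projection of the cover. -/
def coverπ (F : B R R') : cover F ⟶ F :=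
  sumRep.desc fun t => t.2

/-- With V a retract of Rⁿ through s and r, an element y is F(r) of F(s)(y), and the latter indexes
a summand of the cover. -/
theorem coverπ_surjective (F : B R R') (V : RProj R) : Function.Surjective (B.app (coverπ F) V) := by
  intro y
  obtain ⟨n, s, r, h⟩ := V.exists_retract
  refine ⟨lin.of (sumRep.mk ⟨n, F.map s y⟩ r), (sumRep.desc_of _ _ _).trans ?_⟩
  rw [← B.map_comp, h, B.map_id]

/-- The values of a projective object are projective modules. -/
theorem projective_val (F : B R R') [Projective F] (V : RProj R) :
    Module.Projective R' (F.val V) := by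
  have := B.epi_of_surjective (coverπ F) (coverπ_surjective F)
  have h := Projective.factorThru_comp (𝟙 F) (coverπ F)
  have : Module.Projective R' ((cover F).val V) := lin.projective V
  refine Module.Projective.of_split (B.app (Projective.factorThru (𝟙 F) (coverπ F)) V)
    (B.app (coverπ F) V) (LinearMap.ext fun x => ?_)
  rw [LinearMap.comp_apply, ← B.app_comp, h]
  rfl

/-- The iterated kernels of covers. -/
def syzygy (X : B R R') : ℕ → B R R'
  | 0 => X
  | n + 1 => B.ker (coverπ (syzygy X n))

/-- The differential of the resolution by covers. -/
def syzygyD (X : B R R') (n : ℕ) : cover (syzygy X (n + 1)) ⟶ cover (syzygy X n) :=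
  coverπ (B.ker (coverπ (syzygy X n))) ≫ B.kerι (coverπ (syzygy X n))

theorem coverπ_syzygyD (X : B R R') (n : ℕ) (V : RProj R) (x) :
    B.app (coverπ (syzygy X n)) V (B.app (syzygyD X n) V x) = 0 :=
  B.app_app_kerι _ _ _

theorem syzygyD_eq_zero_iff (X : B R R') (n : ℕ) (V : RProj R) (x) :
    B.app (syzygyD X n) V x = 0 ↔ B.app (coverπ (syzygy X (n + 1))) V x = 0 :=
  (B.app_kerι_injective (coverπ (syzygy X n)) V).eq_iff' (map_zero _)

theorem exact_syzygyD_coverπ (X : B R R') (n : ℕ) (V : RProj R) :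
    Function.Exact (B.app (syzygyD X n) V) (B.app (coverπ (syzygy X n)) V) := by
  intro x
  constructor
  · intro hx
    obtain ⟨y, hy⟩ := coverπ_surjective (B.ker (coverπ (syzygy X n))) V (B.ker.mk _ x hx)
    exact ⟨y, congrArg (B.app (B.kerι (coverπ (syzygy X n))) V) hy⟩
  · rintro ⟨y, rfl⟩
    exact coverπ_syzygyD X n V y

/-- The resolution by covers. -/
def coverResolution (X : B R R') : ChainComplex (B R R') ℕ :=
  ChainComplex.of (fun n => cover (syzygy X n)) (syzygyD X) fun n => B.hom_ext fun V x => by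
    rw [B.app_comp, B.app_zero, syzygyD_eq_zero_iff, coverπ_syzygyD]

theorem coverResolution_d (X : B R R') (n : ℕ) : (coverResolution X).d (n + 1) n = syzygyD X n :=
  ChainComplex.of_d (fun n => cover (syzygy X n)) (syzygyD X) n

theorem nonempty_projRes (X : B R R') : Nonempty (ProjRes X) :=
  ⟨{
    P := coverResolution X
    projective := fun n => inferInstanceAs (Projective (cover (syzygy X n)))
    aug := coverπ X
    aug_surjective := coverπ_surjective X
    exact_zero := fun V => by
      rw [coverResolution_d]
      exact exact_syzygyD_coverπ X 0 V
    exact_succ := fun n V x => by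
      rw [coverResolution_d, coverResolution_d]
      exact (syzygyD_eq_zero_iff X n V x).trans (exact_syzygyD_coverπ X (n + 1) V x) }⟩

end Cover

/-! ### The truncation attached to a surjection onto `q_*(I)` -/

namespace SquareZeroExt

/-! ### Diagonality of M, and Ker q as a copy of M -/

section Basic

variable {R M R' : Type u} [CommRing R] [CommRing R'] [AddCommGroup M] [Module R M]
  [Module Rᵐᵒᵖ M] (E : SquareZeroExt R M R')

include E in
-- For a lift r' of r, the two actions are computed by i(m) r' and r' i(m), which agree because R'
-- is commutative.
theorem op_smul (r : R) (m : M) : MulOpposite.op r • m = r • m := by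
  obtain ⟨r, rfl⟩ := E.q_surjective r
  apply E.i_injective
  rw [← E.i_mul, mul_comm, E.mul_i]

theorem q_i (m : M) : E.q (E.i m) = 0 :=
  (E.exact _).2 ⟨m, rfl⟩

/-- The element of `M` given by an element of the kernel of `q`. -/
def ofKer (x : RingHom.ker E.q) : M :=
  ((E.exact x.1).1 x.2).choose

@[simp]
theorem i_ofKer (x : RingHom.ker E.q) : E.i (E.ofKer x) = x :=
  ((E.exact x.1).1 x.2).choose_spec

/-- The isomorphism from the kernel of `q` to `M`. -/
def kerToM : RingHom.ker E.q →ₛₗ[E.q] M where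
  toFun := E.ofKer
  map_add' x y := E.i_injective (by simp)
  map_smul' r x := E.i_injective (by rw [← E.mul_i]; simp)

@[simp]
theorem i_kerToM (x : RingHom.ker E.q) : E.i (E.kerToM x) = x :=
  E.i_ofKer x

/-- The element of the kernel of `q` given by an element of `M`. -/
def toKer (m : M) : RingHom.ker E.q :=
  ⟨E.i m, E.q_i m⟩

@[simp]
theorem kerToM_toKer (m : M) : E.kerToM (E.toKer m) = m :=
  E.i_injective (by rw [i_kerToM]; rfl)

end Basic

/-! ### The four-term exact sequence of a flat cover of `q_*(I)` -/

section Trunc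

variable {R M R' : Type u} [CommRing R] [CommRing R'] [AddCommGroup M] [Module R M]
  [Module Rᵐᵒᵖ M] (E : SquareZeroExt R M R')
  {Q : B R R'} (aug : Q ⟶ qPushTaut E.q)

/-- The values of the augmentation, as elements of `V`. -/
def augVal (V : RProj R) : Q.val V →ₛₗ[E.q] V.obj where
  toFun x := (show V.obj from B.app aug V x)
  map_add' := map_add (B.app aug V)
  map_smul' r x := map_smul (B.app aug V) r x

theorem augVal_map {V W : RProj R} (f : V ⟶ W) (x : Q.val V) :
    E.augVal aug W (Q.map f x) = f.hom.hom (E.augVal aug V x) :=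
  B.app_map aug f x

theorem augVal_i_smul (V : RProj R) (m : M) (x : Q.val V) : E.augVal aug V (E.i m • x) = 0 := by
  rw [map_smulₛₗ, E.q_i, zero_smul]

theorem augVal_kerι (V : RProj R) (k : (B.ker aug).val V) :
    E.augVal aug V (B.app (B.kerι aug) V k) = 0 :=
  B.app_app_kerι aug V k

/-- An element of the kernel of the augmentation. -/
def kerMk (V : RProj R) (x : Q.val V) (hx : E.augVal aug V x = 0) : (B.ker aug).val V :=
  B.ker.mk aug x hx

theorem kerι_kerMk (V : RProj R) (x : Q.val V) (hx : E.augVal aug V x = 0) :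
    B.app (B.kerι aug) V (E.kerMk aug V x hx) = x :=
  rfl

/-- The product of an element of `M` and an element of `Q(V)`, in the kernel of the
augmentation. -/
def mulKer (V : RProj R) (m : M) (x : Q.val V) : (B.ker aug).val V :=
  E.kerMk aug V (E.i m • x) (E.augVal_i_smul aug V m x)

theorem kerι_mulKer (V : RProj R) (m : M) (x : Q.val V) :
    B.app (B.kerι aug) V (E.mulKer aug V m x) = E.i m • x :=
  rfl

/-- The product with a fixed element of `M`. -/
def mulKerLeft (V : RProj R) (m : M) :
    Q.val V →ₛₗ[E.q] ((qPull E.q).obj (B.ker aug)).val V where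
  toFun x := qη E.q _ V (E.mulKer aug V m x)
  map_add' x y := by
    rw [← map_add]
    congr 1
    apply B.app_kerι_injective aug V
    simp only [map_add, kerι_mulKer, smul_add]
  map_smul' r x := by
    rw [← map_smulₛₗ]
    congr 1
    apply B.app_kerι_injective aug V
    simp only [map_smul, kerι_mulKer, smul_comm r]

variable (haug : ∀ V, Function.Surjective (B.app aug V))

include haug in
theorem augVal_surjective (V : RProj R) : Function.Surjective (E.augVal aug V) :=
  haug V

/-- The connecting map for a fixed element of `M`. -/
def connLeft (V : RProj R) (m : M) : V.obj →ₗ[R] ((qPull E.q).obj (B.ker aug)).val V :=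
  descend E.q_surjective (E.augVal aug V) (haug V) (E.mulKerLeft aug V m) fun x hx => by
    -- Independence of the lift: if x already lies in the kernel K, then i(m) x is i(m) times an
    -- element of K, so it vanishes after reduction along q.
    have h : E.mulKer aug V m x = E.i m • E.kerMk aug V x hx :=
      B.app_kerι_injective aug V (by rw [kerι_mulKer, map_smul, kerι_kerMk])
    change qη E.q _ V (E.mulKer aug V m x) = 0
    rw [h, map_smulₛₗ, E.q_i, zero_smul]

theorem connLeft_augVal (V : RProj R) (m : M) (x : Q.val V) :
    E.connLeft aug haug V m (E.augVal aug V x) = qη E.q _ V (E.mulKer aug V m x) :=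
  descend_apply _ _ _ _ _ x

theorem connLeft_smul (V : RProj R) (r : R) (m : M) (v : V.obj) :
    E.connLeft aug haug V (r • m) v = r • E.connLeft aug haug V m v := by
  obtain ⟨x, rfl⟩ := E.augVal_surjective aug haug V v
  obtain ⟨r, rfl⟩ := E.q_surjective r
  rw [connLeft_augVal, connLeft_augVal, ← map_smulₛₗ]
  congr 1
  apply B.app_kerι_injective aug V
  rw [map_smul, kerι_mulKer, kerι_mulKer, ← E.mul_i, mul_smul]

theorem augVal_eq_zero_of_qη_eq_zero (V : RProj R) (x : Q.val V) (hx : qη E.q Q V x = 0) :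
    E.augVal aug V x = 0 := by
  rw [qη_eq_zero_iff E.q_surjective] at hx
  refine Submodule.smul_induction_on hx (fun r hr y _ => ?_) (fun y z hy hz => ?_)
  · rw [map_smulₛₗ, (hr : E.q r = 0), zero_smul]
  · rw [map_add, hy, hz, add_zero]

/-- The augmentation `R ⊗_{R'} Q(V) → V`. -/
def augPullVal (V : RProj R) : ((qPull E.q).obj Q).val V →ₗ[R] V.obj :=
  descend E.q_surjective (qη E.q Q V) (qη_surjective E.q_surjective Q V) (E.augVal aug V)
    (E.augVal_eq_zero_of_qη_eq_zero aug V)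

theorem augPullVal_qη (V : RProj R) (x : Q.val V) :
    E.augPullVal aug V (qη E.q Q V x) = E.augVal aug V x :=
  descend_apply _ _ _ _ _ x

/-- The augmentation `R ⊗_{R'} Q → I`. -/
def augPull : (qPull E.q).obj Q ⟶ tautFunctor R :=
  B.mkHom (E.augPullVal aug) fun {V W} f x => by
    obtain ⟨x, rfl⟩ := qη_surjective E.q_surjective Q V x
    exact (E.augPullVal_qη aug W _).trans ((E.augVal_map aug f x).trans
      (congrArg f.hom.hom (E.augPullVal_qη aug V x)).symm)

theorem augPull_qη (V : RProj R) (x : Q.val V) :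
    B.app (E.augPull aug) V (qη E.q Q V x) = E.augVal aug V x :=
  E.augPullVal_qη aug V x

/-- The multiplication map `I ⊗ Q(V) → Q(V)` for the kernel `I` of `q`. -/
def kerSMul (V : RProj R) : RingHom.ker E.q ⊗[R'] Q.val V →ₗ[R'] Q.val V :=
  TensorProduct.lift (LinearMap.lsmul R' (Q.val V) ∘ₗ (RingHom.ker E.q).subtype)

theorem kerSMul_tmul (V : RProj R) (x : RingHom.ker E.q) (y : Q.val V) :
    E.kerSMul V (x ⊗ₜ y) = (x : R') • y :=
  rfl

theorem exact_augPull (V : RProj R) :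
    Function.Exact (B.app ((qPull E.q).map (B.kerι aug)) V) (B.app (E.augPull aug) V) := by
  intro c
  constructor
  · obtain ⟨x, rfl⟩ := qη_surjective E.q_surjective _ V c
    intro h
    replace h : E.augVal aug V x = 0 := (E.augPull_qη aug V x).symm.trans h
    exact ⟨qη E.q _ V (E.kerMk aug V x h), by rw [qη_app, kerι_kerMk]⟩
  · rintro ⟨k, rfl⟩
    obtain ⟨k, rfl⟩ := qη_surjective E.q_surjective _ V k
    rw [qη_app, augPull_qη, augVal_kerι]
    rfl

/-- The inclusion of Ker q in R' stays injective after tensoring with the flat module Q(V). The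
exactness argument uses flatness only here. -/
theorem kerSMul_injective (V : RProj R) [Module.Flat R' (Q.val V)] :
    Function.Injective (E.kerSMul (Q := Q) V) := by
  rw [kerSMul, ← LinearMap.lid_comp_rTensor]
  exact (TensorProduct.lid R' (Q.val V)).injective.comp
    (Module.Flat.rTensor_preserves_injective_linearMap _ Subtype.val_injective)

variable [SMulCommClass Rᵐᵒᵖ R M]

/-- The pure tensor `m ⊗ v` as an element of `I(M)(V)`. -/
def pure (V : RProj R) (m : M) (v : V.obj) : (bimodFunctor R M).val V :=
  btmul R M m v

theorem pure_add_left (V : RProj R) (m m' : M) (v : V.obj) :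
    pure V (m + m') v = pure V m v + pure V m' v :=
  TensorProduct.add_tmul _ _ _

theorem pure_add_right (V : RProj R) (m : M) (v v' : V.obj) :
    pure V m (v + v') = pure V m v + pure V m v' :=
  TensorProduct.tmul_add _ _ _

theorem pure_zero_right (V : RProj R) (m : M) : pure V m 0 = 0 :=
  TensorProduct.tmul_zero _ _

include E in
theorem pure_smul (V : RProj R) (r : R) (m : M) (v : V.obj) :
    pure V m (r • v) = pure V (r • m) v := by
  rw [← op_smul E]
  exact (TensorProduct.smul_tmul (MulOpposite.op r) m (show OpMod V.obj from v)).symm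

/-- The connecting map `M ⊗_R V → R ⊗_{R'} K(V)`, where `K` is the kernel of the augmentation. -/
def connAdd (V : RProj R) : (bimodFunctor R M).val V →+ ((qPull E.q).obj (B.ker aug)).val V :=
  TensorProduct.liftAddHom
    (AddMonoidHom.mk' (fun m => ((E.connLeft aug haug V m).toAddMonoidHom :
        OpMod V.obj →+ ((qPull E.q).obj (B.ker aug)).val V)) fun m m' => by
      apply AddMonoidHom.ext
      intro (v : V.obj)
      change E.connLeft aug haug V (m + m') v =
        E.connLeft aug haug V m v + E.connLeft aug haug V m' v
      obtain ⟨x, rfl⟩ := E.augVal_surjective aug haug V v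
      rw [connLeft_augVal, connLeft_augVal, connLeft_augVal, ← map_add]
      congr 1
      apply B.app_kerι_injective aug V
      simp only [map_add, kerι_mulKer, add_smul])
    fun r m (v : V.obj) => by
      change E.connLeft aug haug V (MulOpposite.op r.unop • m) v =
        E.connLeft aug haug V m (r.unop • v)
      rw [op_smul E, connLeft_smul, map_smul]

theorem connAdd_pure (V : RProj R) (m : M) (x : Q.val V) :
    E.connAdd aug haug V (pure V m (E.augVal aug V x)) =
      qη E.q _ V (E.mulKer aug V m x) :=
  E.connLeft_augVal aug haug V m x

/-- Induction on elements of `M ⊗_R V`, with lifts of elements of `V` to `Q(V)`. -/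
@[elab_as_elim]
theorem bimodTensor_induction (V : RProj R) {p : (bimodFunctor R M).val V → Prop}
    (haug : Function.Surjective (B.app aug V))
    (z : (bimodFunctor R M).val V) (zero : p 0)
    (tmul : ∀ m x, p (pure V m (E.augVal aug V x)))
    (add : ∀ z z', p z → p z' → p (z + z')) : p z := by
  induction z using TensorProduct.induction_on with
  | zero => exact zero
  | tmul m v =>
    obtain ⟨x, hx⟩ := haug v
    exact (congrArg (fun v => p (pure V m v)) hx).mp (tmul m x)
  | add z z' hz hz' => exact add z z' hz hz'

/-- The map `I ⊗ Q(V) → M ⊗_R V` for the kernel `I` of `q`. -/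
def kerTensor (V : RProj R) : RingHom.ker E.q ⊗[R'] Q.val V →+ (bimodFunctor R M).val V :=
  TensorProduct.liftAddHom
    (AddMonoidHom.mk' (fun x => AddMonoidHom.mk'
        (fun y : Q.val V => pure V (E.kerToM x) (E.augVal aug V y)) fun y y' => by
          rw [map_add, pure_add_right]) fun x x' => AddMonoidHom.ext fun y => by
      change pure V (E.kerToM (x + x')) (E.augVal aug V y) = _
      rw [map_add, pure_add_left]
      rfl)
    fun r x y => by
      change pure V (E.kerToM (r • x)) (E.augVal aug V y) =
        pure V (E.kerToM x) (E.augVal aug V (r • y))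
      rw [map_smulₛₗ, map_smulₛₗ, pure_smul E]

theorem kerTensor_tmul (V : RProj R) (x : RingHom.ker E.q) (y : Q.val V) :
    E.kerTensor aug V (x ⊗ₜ y) = pure V (E.kerToM x) (E.augVal aug V y) :=
  rfl

/-- The connecting map as a linear map. -/
def conn (V : RProj R) :
    (bimodFunctor R M).val V →ₗ[R] ((qPull E.q).obj (B.ker aug)).val V where
  toFun := E.connAdd aug haug V
  map_add' := map_add _
  map_smul' r z := by
    refine E.bimodTensor_induction aug V (haug V) z ?_ ?_ ?_
    · rw [smul_zero, map_zero, smul_zero]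
    · intro m x
      exact E.connLeft_smul aug haug V r m (E.augVal aug V x)
    · intro z z' hz hz'
      rw [smul_add, map_add, hz, hz', map_add, smul_add]

theorem conn_pure (V : RProj R) (m : M) (x : Q.val V) :
    E.conn aug haug V (pure V m (E.augVal aug V x)) = qη E.q _ V (E.mulKer aug V m x) :=
  E.connAdd_pure aug haug V m x

theorem map_pure {V W : RProj R} (f : V ⟶ W) (m : M) (v : V.obj) :
    (bimodFunctor R M).map f (pure V m v) = pure W m (f.hom.hom v) :=
  rfl

/-- The connecting map as a morphism of functors. -/
def connHom : bimodFunctor R M ⟶ (qPull E.q).obj (B.ker aug) :=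
  B.mkHom (E.conn aug haug) fun {V W} f z => by
    refine E.bimodTensor_induction aug V (haug V) z ?_ ?_ ?_
    · simp only [map_zero]
    · intro m x
      rw [map_pure, ← augVal_map, conn_pure, conn_pure, qη_map]
      congr 1
      apply B.app_kerι_injective aug W
      rw [B.app_map, kerι_mulKer, kerι_mulKer, map_smul]
    · intro z z' hz hz'
      simp only [map_add, hz, hz']

theorem connHom_pure (V : RProj R) (m : M) (x : Q.val V) :
    B.app (E.connHom aug haug) V (pure V m (E.augVal aug V x)) =
      qη E.q _ V (E.mulKer aug V m x) :=
  E.conn_pure aug haug V m x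

/-- Ker q ⊗ Q(V) maps both to M ⊗_R V and, by multiplication, to Q(V). A common lift y shows that
the connecting map is "lift, then multiply". -/
theorem exists_kerTensor_eq (V : RProj R) (z : (bimodFunctor R M).val V) :
    ∃ y : RingHom.ker E.q ⊗[R'] Q.val V, E.kerTensor aug V y = z ∧
      ∃ k, B.app (E.connHom aug haug) V z = qη E.q _ V k ∧
        B.app (B.kerι aug) V k = E.kerSMul V y := by
  refine E.bimodTensor_induction aug V (haug V) z ?_ ?_ ?_
  · exact ⟨0, map_zero _, 0, by rw [map_zero, map_zero], by rw [map_zero, map_zero]⟩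
  · intro m x
    refine ⟨E.toKer m ⊗ₜ x, by rw [kerTensor_tmul, kerToM_toKer], E.mulKer aug V m x,
      E.connHom_pure aug haug V m x, rfl⟩
  · rintro _ _ ⟨y, rfl, k, h, hk⟩ ⟨y', rfl, k', h', hk'⟩
    exact ⟨y + y', map_add _ _ _, k + k', by rw [map_add, h, h', map_add],
      by rw [map_add, hk, hk', map_add]⟩

/-- Such a k is a sum of products r k' with r ∈ Ker q and k' ∈ K; the tensors r ⊗ k' die in M ⊗_R V
because the augmentation kills k'. -/
theorem exists_kerSMul_eq (V : RProj R) (k : (B.ker aug).val V) (hk : qη E.q _ V k = 0) :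
    ∃ y : RingHom.ker E.q ⊗[R'] Q.val V, E.kerTensor aug V y = 0 ∧
      B.app (B.kerι aug) V k = E.kerSMul V y := by
  rw [qη_eq_zero_iff E.q_surjective] at hk
  refine Submodule.smul_induction_on hk (fun r hr k _ => ?_) ?_
  · refine ⟨⟨r, hr⟩ ⊗ₜ B.app (B.kerι aug) V k, ?_, ?_⟩
    · rw [kerTensor_tmul, augVal_kerι, pure_zero_right]
    · rw [kerSMul_tmul, map_smul]
  · rintro k k' ⟨y, hy, h⟩ ⟨y', hy', h'⟩
    exact ⟨y + y', by rw [map_add, hy, hy', add_zero], by rw [map_add, h, h', map_add]⟩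

/-- If z maps to 0, the same element of Q(V) is the product of a lift y of z and of some y' that
dies in M ⊗_R V. Injectivity of multiplication gives y = y', so z = 0. -/
theorem connHom_injective (V : RProj R) [Module.Flat R' (Q.val V)] :
    Function.Injective (B.app (E.connHom aug haug) V) := by
  rw [injective_iff_map_eq_zero]
  intro z hz
  obtain ⟨y, rfl, k, h, hk⟩ := E.exists_kerTensor_eq aug haug V z
  obtain ⟨y', hy', h'⟩ := E.exists_kerSMul_eq aug V k (h.symm.trans hz)
  rw [E.kerSMul_injective V (hk.symm.trans h')]
  exact hy'

/-- A class of K killed in Q(V)/(Ker q · Q(V)) is represented by a sum of products i(m) x with x ∈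
Q(V), and i(m) x represents the image of m ⊗ aug(x). -/
theorem exact_connHom (V : RProj R) :
    Function.Exact (B.app (E.connHom aug haug) V)
      (B.app ((qPull E.q).map (B.kerι aug)) V) := by
  intro c
  constructor
  · obtain ⟨k, rfl⟩ := qη_surjective E.q_surjective _ V c
    intro h
    rw [qη_app, qη_eq_zero_iff E.q_surjective] at h
    have key : ∃ z k', B.app (E.connHom aug haug) V z = qη E.q _ V k' ∧
        B.app (B.kerι aug) V k' = B.app (B.kerι aug) V k := by
      refine Submodule.smul_induction_on (p := fun x => ∃ z k',
        B.app (E.connHom aug haug) V z = qη E.q _ V k' ∧ B.app (B.kerι aug) V k' = x) h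
        (fun r hr x _ => ?_) ?_
      · refine ⟨pure V (E.kerToM ⟨r, hr⟩) (E.augVal aug V x), _,
          E.connHom_pure aug haug V _ x, ?_⟩
        rw [kerι_mulKer, i_kerToM]
      · rintro _ _ ⟨z, k, h, rfl⟩ ⟨z', k', h', rfl⟩
        exact ⟨z + z', k + k', by rw [map_add, h, h', map_add], map_add _ _ _⟩
    obtain ⟨z, k', hz, hk⟩ := key
    exact ⟨z, by rw [hz, B.app_kerι_injective aug V hk]⟩
  · rintro ⟨z, rfl⟩
    refine E.bimodTensor_induction aug V (haug V) z ?_ ?_ ?_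
    · rw [map_zero, map_zero]
    · intro m x
      rw [connHom_pure, qη_app, kerι_mulKer, map_smulₛₗ, E.q_i, zero_smul]
    · intro z z' hz hz'
      rw [map_add, map_add, hz, hz', add_zero]

/-- The elementary extension `0 → I(M) → R ⊗_{R'} K → R ⊗_{R'} Q → I → 0` attached to a surjection
`Q → q_*(I)` with kernel `K`, for a pointwise flat functor `Q`. -/
def trunc (hflat : ∀ V, Module.Flat R' (Q.val V)) : ElemExt R M where
  C₁ := (qPull E.q).obj (B.ker aug)
  C₀ := (qPull E.q).obj Q
  b := E.connHom aug haug
  d := (qPull E.q).map (B.kerι aug)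
  a := E.augPull aug
  b_injective V := have := hflat V; E.connHom_injective aug haug V
  exact₁ := E.exact_connHom aug haug
  exact₀ := E.exact_augPull aug
  a_surjective V v := by
    obtain ⟨x, rfl⟩ := E.augVal_surjective aug haug V v
    exact ⟨_, E.augPull_qη aug V x⟩

/-- The map of elementary extensions given by a map over `q_*(I)`. -/
def truncMap {Q' : B R R'} {aug' : Q' ⟶ qPushTaut E.q}
    {haug' : ∀ V, Function.Surjective (B.app aug' V)} {hflat : ∀ V, Module.Flat R' (Q.val V)}
    {hflat' : ∀ V, Module.Flat R' (Q'.val V)} (t : Q ⟶ Q') (ht : t ≫ aug' = aug) :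
    E.trunc aug haug hflat ⟶ E.trunc aug' haug' hflat' :=
  have ht' : ∀ V x, B.app aug' V (B.app t V x) = B.app aug V x := fun V x => by rw [← ht]; rfl
  have h : ∀ V x, B.app aug' V (B.app (B.kerι aug ≫ t) V x) = 0 := fun V x => by
    rw [B.app_comp, ht', B.app_app_kerι]
  { f₁ := (qPull E.q).map (B.kerLift aug' (B.kerι aug ≫ t) h)
    f₀ := (qPull E.q).map t
    comm_b := B.hom_ext fun V z => by
      change B.app ((qPull E.q).map (B.kerLift aug' (B.kerι aug ≫ t) h)) V
        (B.app (E.connHom aug haug) V z) = B.app (E.connHom aug' haug') V z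
      refine E.bimodTensor_induction aug V (haug V) z ?_ ?_ ?_
      · simp only [map_zero]
      · intro m x
        have hx : E.augVal aug V x = E.augVal aug' V (B.app t V x) := (ht' V x).symm
        rw [connHom_pure, hx, connHom_pure, qη_app]
        congr 1
        apply B.app_kerι_injective aug' V
        rw [B.app_kerι_kerLift, B.app_comp, kerι_mulKer, kerι_mulKer, map_smul]
      · intro z z' hz hz'
        simp only [map_add, hz, hz']
    comm_d := by
      change (qPull E.q).map _ ≫ (qPull E.q).map _ = (qPull E.q).map _ ≫ (qPull E.q).map _
      rw [← Functor.map_comp, ← Functor.map_comp]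
      rfl
    comm_a := B.hom_ext fun V x => by
      obtain ⟨x, rfl⟩ := qη_surjective E.q_surjective _ V x
      change B.app (E.augPull aug') V (B.app ((qPull E.q).map t) V (qη E.q _ V x)) =
        B.app (E.augPull aug) V (qη E.q _ V x)
      rw [qη_app, augPull_qη, augPull_qη]
      exact ht' V x }

/-- The truncation attached to `P₀ → q_*(I)` is the truncation `τ_{[0,1]} q^* P` of a projective
resolution. -/
def truncationIso (P : ProjRes (qPushTaut E.q)) (hflat : ∀ V, Module.Flat R' ((P.P.X 0).val V)) :
    TruncationIso E P (E.trunc P.aug P.aug_surjective hflat) :=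
  have h0 : ∀ V x, B.app P.aug V (B.app (P.P.d 1 0) V x) = 0 := fun V x =>
    (P.exact_zero V _).2 ⟨x, rfl⟩
  have hs : ∀ V, Function.Surjective (B.app (B.kerLift P.aug (P.P.d 1 0) h0) V) := fun V k => by
    obtain ⟨w, hw⟩ := (P.exact_zero V _).1 (B.app_app_kerι P.aug V k)
    exact ⟨w, B.app_kerι_injective P.aug V hw⟩
  { t₀ := Iso.refl _
    t₁ := (qPull E.q).map (B.kerLift P.aug (P.P.d 1 0) h0)
    t₁_surjective := fun V k => by
      obtain ⟨k, rfl⟩ := qη_surjective E.q_surjective _ V k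
      obtain ⟨w, rfl⟩ := hs V k
      exact ⟨qη E.q _ V w, rfl⟩
    t₁_exact := fun V c => by
      constructor
      · obtain ⟨w, rfl⟩ := qη_surjective E.q_surjective _ V c
        intro h
        replace h : qη E.q _ V (B.app (B.kerLift P.aug (P.P.d 1 0) h0) V w) = 0 := h
        rw [qη_eq_zero_iff E.q_surjective] at h
        -- P₁ → K is onto, so Ker q · P₁ maps onto Ker q · K; this corrects w by an element y that
        -- is invisible after reduction. The difference w − y is then a cycle, hence a boundary from
        -- P₂.
        have key : ∃ y, qη E.q _ V y = 0 ∧ B.app (B.kerLift P.aug (P.P.d 1 0) h0) V y =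
            B.app (B.kerLift P.aug (P.P.d 1 0) h0) V w := by
          refine Submodule.smul_induction_on (p := fun k => ∃ y, qη E.q _ V y = 0 ∧
            B.app (B.kerLift P.aug (P.P.d 1 0) h0) V y = k) h (fun r hr k _ => ?_) ?_
          · obtain ⟨y, rfl⟩ := hs V k
            exact ⟨r • y, by rw [map_smulₛₗ, (hr : E.q r = 0), zero_smul], map_smul _ _ _⟩
          · rintro _ _ ⟨y, hy, rfl⟩ ⟨y', hy', rfl⟩
            exact ⟨y + y', by rw [map_add, hy, hy', add_zero], map_add _ _ _⟩
        obtain ⟨y, hy, hyw⟩ := key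
        have h1 : B.app (P.P.d 1 0) V (w - y) = 0 := by
          rw [map_sub, sub_eq_zero]
          exact congrArg (B.app (B.kerι P.aug) V) hyw.symm
        obtain ⟨x, hx⟩ := (P.exact_succ 0 V _).1 h1
        refine ⟨qη E.q _ V x, ?_⟩
        rw [qη_app, hx, map_sub, hy, sub_zero]
      · rintro ⟨x, rfl⟩
        obtain ⟨x, rfl⟩ := qη_surjective E.q_surjective _ V x
        have h1 : B.app (B.kerLift P.aug (P.P.d 1 0) h0) V (B.app (P.P.d 2 1) V x) = 0 :=
          B.app_kerι_injective P.aug V (((P.exact_succ 0 V _).2 ⟨x, rfl⟩).trans (map_zero _).symm)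
        exact (congrArg (qη E.q _ V) h1).trans (map_zero _)
    comm_d := by
      rw [Iso.refl_hom]
      change (qPull E.q).map _ ≫ (qPull E.q).map _ = (qPull E.q).map _ ≫ 𝟙 _
      rw [← Functor.map_comp, Category.comp_id]
      rfl
    comm_a := fun V p => E.augPull_qη P.aug V p
    comm_b := fun V m p w h => by
      refine (E.connHom_pure P.aug P.aug_surjective V m p).trans ?_
      refine congrArg (qη E.q _ V) (B.app_kerι_injective P.aug V ?_)
      exact h.symm }

end Trunc

end SquareZeroExt

/-! ### Bilinear maps on `R ⊗_{R'} -` -/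

section PullMul

variable {R R' : Type u} [CommRing R] [CommRing R'] {q : R' →+* R} (hq : Function.Surjective q)
  {F G H : B R R'} {V V' W : RProj R}

include hq in
-- Linearity carries Ker q · F(V) into Ker q · G(W). This is what makes linear and bilinear maps
-- descend to R ⊗_{R'} -.
theorem qη_linear_eq_zero (f : F.val V →ₗ[R'] G.val W) {x : F.val V} (hx : qη q F V x = 0) :
    qη q G W (f x) = 0 := by
  rw [qη_eq_zero_iff hq] at hx ⊢
  refine Submodule.smul_induction_on hx (fun r hr y _ => ?_) (fun y z hy hz => ?_)
  · rw [map_smul]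
    exact Submodule.smul_mem_smul hr Submodule.mem_top
  · rw [map_add]
    exact add_mem hy hz

/-- The map `R ⊗_{R'} F(V) → R ⊗_{R'} G(W)` induced by a linear map `F(V) → G(W)`. -/
def pullLin (f : F.val V →ₗ[R'] G.val W) :
    ((qPull q).obj F).val V →ₗ[R] ((qPull q).obj G).val W :=
  descend hq (qη q F V) (qη_surjective hq F V) ((qη q G W).comp f) fun _ hx =>
    qη_linear_eq_zero hq f hx

theorem pullLin_qη (f : F.val V →ₗ[R'] G.val W) (x : F.val V) :
    pullLin hq f (qη q F V x) = qη q G W (f x) :=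
  descend_apply hq (qη q F V) (qη_surjective hq F V) ((qη q G W).comp f) _ x

include hq in
theorem pull_ext {L : Type*} [AddCommGroup L] [Module R L]
    {f g : ((qPull q).obj F).val V →ₗ[R] L} (h : ∀ x, f (qη q F V x) = g (qη q F V x)) : f = g :=
  LinearMap.ext fun y => by
    obtain ⟨x, rfl⟩ := qη_surjective hq F V y
    exact h x

/-- The bilinear map on `R ⊗_{R'} -` induced by a bilinear map. -/
def pullMul (μ : F.val V →ₗ[R'] G.val V' →ₗ[R'] H.val W) :
    ((qPull q).obj F).val V →ₗ[R] ((qPull q).obj G).val V' →ₗ[R] ((qPull q).obj H).val W :=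
  descend hq (qη q F V) (qη_surjective hq F V)
    { toFun := fun x => pullLin hq (μ x)
      map_add' := fun x y => pull_ext hq fun z => by
        rw [LinearMap.add_apply, pullLin_qη, pullLin_qη, pullLin_qη, map_add,
          LinearMap.add_apply, map_add]
      map_smul' := fun r x => pull_ext hq fun z => by
        rw [LinearMap.smul_apply, pullLin_qη, pullLin_qη, map_smul, LinearMap.smul_apply,
          map_smulₛₗ] }
    fun x hx => pull_ext hq fun y => by
      rw [LinearMap.zero_apply]
      exact (pullLin_qη hq (μ x) y).trans (qη_linear_eq_zero hq (μ.flip y) hx)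

theorem pullMul_qη (μ : F.val V →ₗ[R'] G.val V' →ₗ[R'] H.val W) (x : F.val V) (y : G.val V') :
    pullMul hq μ (qη q F V x) (qη q G V' y) = qη q H W (μ x y) := by
  rw [pullMul, descend_apply]
  exact pullLin_qη hq (μ x) y

theorem pullMul_map {F G H : B R R'} {V V' W V₂ V₂' W₂ : RProj R}
    (μ : F.val V →ₗ[R'] G.val V' →ₗ[R'] H.val W)
    (μ₂ : F.val V₂ →ₗ[R'] G.val V₂' →ₗ[R'] H.val W₂) (f : V ⟶ V₂) (g : V' ⟶ V₂') (h : W ⟶ W₂)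
    (H' : ∀ x y, H.map h (μ x y) = μ₂ (F.map f x) (G.map g y)) (x y) :
    ((qPull q).obj H).map h (pullMul hq μ x y) =
      pullMul hq μ₂ (((qPull q).obj F).map f x) (((qPull q).obj G).map g y) := by
  obtain ⟨x, rfl⟩ := qη_surjective hq F V x
  obtain ⟨y, rfl⟩ := qη_surjective hq G V' y
  rw [pullMul_qη, qη_map, qη_map, qη_map, pullMul_qη, H']

theorem pullMul_app_right {F G G₂ H H₂ : B R R'} {V V' W : RProj R}
    (μ : F.val V →ₗ[R'] G.val V' →ₗ[R'] H.val W)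
    (μ₂ : F.val V →ₗ[R'] G₂.val V' →ₗ[R'] H₂.val W) (s : G ⟶ G₂) (t : H ⟶ H₂)
    (H' : ∀ x y, B.app t W (μ x y) = μ₂ x (B.app s V' y)) (x y) :
    B.app ((qPull q).map t) W (pullMul hq μ x y) =
      pullMul hq μ₂ x (B.app ((qPull q).map s) V' y) := by
  obtain ⟨x, rfl⟩ := qη_surjective hq F V x
  obtain ⟨y, rfl⟩ := qη_surjective hq G V' y
  rw [pullMul_qη, qη_app, qη_app, pullMul_qη, H']

theorem pullMul_app_left {F F₂ G H H₂ : B R R'} {V V' W : RProj R}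
    (μ : F.val V →ₗ[R'] G.val V' →ₗ[R'] H.val W)
    (μ₂ : F₂.val V →ₗ[R'] G.val V' →ₗ[R'] H₂.val W) (s : F ⟶ F₂) (t : H ⟶ H₂)
    (H' : ∀ x y, B.app t W (μ x y) = μ₂ (B.app s V x) y) (x y) :
    B.app ((qPull q).map t) W (pullMul hq μ x y) =
      pullMul hq μ₂ (B.app ((qPull q).map s) V x) y := by
  obtain ⟨x, rfl⟩ := qη_surjective hq F V x
  obtain ⟨y, rfl⟩ := qη_surjective hq G V' y
  rw [pullMul_qη, qη_app, qη_app, pullMul_qη, H']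

theorem pullMul_app_balanced {F F₂ G G₂ H : B R R'} {V V' W : RProj R}
    (μ : F₂.val V →ₗ[R'] G.val V' →ₗ[R'] H.val W)
    (μ₂ : F.val V →ₗ[R'] G₂.val V' →ₗ[R'] H.val W) (s : F ⟶ F₂) (t : G ⟶ G₂)
    (H' : ∀ x y, μ (B.app s V x) y = μ₂ x (B.app t V' y)) (x y) :
    pullMul hq μ (B.app ((qPull q).map s) V x) y =
      pullMul hq μ₂ x (B.app ((qPull q).map t) V' y) := by
  obtain ⟨x, rfl⟩ := qη_surjective hq F V x
  obtain ⟨y, rfl⟩ := qη_surjective hq G V' y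
  rw [qη_app, qη_app, pullMul_qη, pullMul_qη, H']

theorem pullMul_assoc {F G H K K' L : B R R'} {U V W X X' Y Y' : RProj R}
    (μ : F.val U →ₗ[R'] G.val V →ₗ[R'] K.val X) (ν : K.val X →ₗ[R'] H.val W →ₗ[R'] L.val Y)
    (μ' : G.val V →ₗ[R'] H.val W →ₗ[R'] K'.val X') (ν' : F.val U →ₗ[R'] K'.val X' →ₗ[R'] L.val Y')
    (a : Y ⟶ Y') (H' : ∀ x y z, L.map a (ν (μ x y) z) = ν' x (μ' y z)) (x y z) :
    ((qPull q).obj L).map a (pullMul hq ν (pullMul hq μ x y) z) =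
      pullMul hq ν' x (pullMul hq μ' y z) := by
  obtain ⟨x, rfl⟩ := qη_surjective hq F U x
  obtain ⟨y, rfl⟩ := qη_surjective hq G V y
  obtain ⟨z, rfl⟩ := qη_surjective hq H W z
  rw [pullMul_qη, pullMul_qη, pullMul_qη, pullMul_qη, qη_map, H']

theorem pullMul_one_left {F G : B R R'} {V V' W : RProj R}
    (μ : F.val V →ₗ[R'] G.val V' →ₗ[R'] G.val W) (o : F.val V) (a : W ⟶ V')
    (H' : ∀ x, G.map a (μ o x) = x) (r : R) (x) :
    ((qPull q).obj G).map a (pullMul hq μ (r • qη q F V o) x) = r • x := by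
  obtain ⟨x, rfl⟩ := qη_surjective hq G V' x
  rw [map_smul, LinearMap.smul_apply, map_smul, pullMul_qη, qη_map, H']

theorem pullMul_one_right {F G : B R R'} {V V' W : RProj R}
    (μ : G.val V →ₗ[R'] F.val V' →ₗ[R'] G.val W) (o : F.val V') (a : W ⟶ V)
    (H' : ∀ x, G.map a (μ x o) = x) (x) (r : R) :
    ((qPull q).obj G).map a (pullMul hq μ x (r • qη q F V' o)) = r • x := by
  obtain ⟨x, rfl⟩ := qη_surjective hq G V x
  rw [map_smul, map_smul, pullMul_qη, qη_map, H']

end PullMul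

/-! ### Elements of tensor products -/

namespace RProj

variable {R : Type u} [CommRing R]

/-- The pure tensor `v ⊗ w`. -/
def tmul {V W : RProj R} (v : V.obj) (w : W.obj) : (tensor V W).obj :=
  v ⊗ₜ[R] w

/-- The element `1` of `R`. -/
def unit (R : Type u) [CommRing R] : (one R).obj :=
  (1 : R)

variable {V V' W W' : RProj R}

theorem add_tmul (v v' : V.obj) (w : W.obj) : tmul (v + v') w = tmul v w + tmul v' w :=
  TensorProduct.add_tmul v v' w

theorem tmul_add (v : V.obj) (w w' : W.obj) : tmul v (w + w') = tmul v w + tmul v w' :=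
  TensorProduct.tmul_add v w w'

theorem smul_tmul (r : R) (v : V.obj) (w : W.obj) : tmul (r • v) w = r • tmul v w :=
  rfl

theorem tmul_smul (r : R) (v : V.obj) (w : W.obj) : tmul v (r • w) = r • tmul v w :=
  TensorProduct.tmul_smul r v w

theorem zero_tmul (w : W.obj) : tmul (0 : V.obj) w = 0 :=
  TensorProduct.zero_tmul _ w

theorem tmul_zero (v : V.obj) : tmul v (0 : W.obj) = 0 :=
  TensorProduct.tmul_zero _ v

theorem tensorMap_tmul (f : V ⟶ V') (g : W ⟶ W') (v : V.obj) (w : W.obj) :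
    (tensorMap f g).hom.hom (tmul v w) = tmul (f.hom.hom v) (g.hom.hom w) :=
  rfl

theorem assoc_tmul {U : RProj R} (u : U.obj) (v : V.obj) (w : W.obj) :
    (assoc U V W).hom.hom (tmul (tmul u v) w) = tmul u (tmul v w) :=
  rfl

theorem lid_tmul (v : V.obj) : (lid V).hom.hom (tmul (unit R) v) = v :=
  one_smul R v

theorem rid_tmul (v : V.obj) : (rid V).hom.hom (tmul v (unit R)) = v :=
  one_smul R v

end RProj

/-! ### The reduced group ring functor -/

section GroupRing

variable (R R' : Type u) [CommRing R] [CommRing R']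

/-- The pointed functor `V ↦ R'[V] / R'[0]`. -/
def groupRing : B R R' :=
  lin R' ((isFGProj R).ι ⋙ forget (ModuleCat.{u} R))

variable {R R'}

/-- The generator `[v]`. -/
def br {V : RProj R} (v : V.obj) : (groupRing R R').val V :=
  lin.of (S := (isFGProj R).ι ⋙ forget (ModuleCat.{u} R)) v

theorem groupRing_map_br {V W : RProj R} (f : V ⟶ W) (v : V.obj) :
    (groupRing R R').map f (br v) = br (f.hom.hom v) :=
  lin.map_of (S := (isFGProj R).ι ⋙ forget (ModuleCat.{u} R)) f v

theorem br_zero (V : RProj R) : (br 0 : (groupRing R R').val V) = 0 :=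
  lin.of_basepoint (S := (isFGProj R).ι ⋙ forget (ModuleCat.{u} R)) (0 : V.obj)

/-- The linear map with prescribed values on the generators. -/
def groupRing.desc {V : RProj R} {N : Type*} [AddCommGroup N] [Module R' N] (g : V.obj → N)
    (hg : g 0 = 0) : (groupRing R R').val V →ₗ[R'] N :=
  lin.desc (S := (isFGProj R).ι ⋙ forget (ModuleCat.{u} R)) g fun _ => hg

theorem groupRing.desc_br {V : RProj R} {N : Type*} [AddCommGroup N] [Module R' N]
    (g : V.obj → N) (hg : g 0 = 0) (v : V.obj) :
    groupRing.desc (R' := R') g hg (br v) = g v :=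
  lin.desc_of (S := (isFGProj R).ι ⋙ forget (ModuleCat.{u} R)) g (fun _ => hg) v

theorem groupRing.hom_ext {V : RProj R} {N : Type*} [AddCommGroup N] [Module R' N]
    {g h : (groupRing R R').val V →ₗ[R'] N} (H : ∀ v : V.obj, g (br v) = h (br v)) : g = h :=
  lin.hom_ext (S := (isFGProj R).ι ⋙ forget (ModuleCat.{u} R)) H

theorem groupRing.induction {V : RProj R} {p : (groupRing R R').val V → Prop}
    (x : (groupRing R R').val V) (zero : p 0) (br : ∀ v : V.obj, p (br v))
    (add : ∀ x y, p x → p y → p (x + y)) (smul : ∀ (r : R') x, p x → p (r • x)) : p x :=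
  lin.induction (S := (isFGProj R).ι ⋙ forget (ModuleCat.{u} R)) x zero br add smul

instance groupRing.projective (V : RProj R) : Module.Projective R' ((groupRing R R').val V) :=
  lin.projective V

/-- The map `V → F(V)` given by an element of `F(R)`. -/
def evalAt {F : B R R'} (p : F.val (RProj.one R)) (V : RProj R) (v : V.obj) : F.val V :=
  F.map (ObjectProperty.homMk (ModuleCat.ofHom (LinearMap.toSpanSingleton R V.obj v)) :
    RProj.one R ⟶ V) p

/-- Elements v of V are maps R → V, 1 ↦ v, and composing with f gives the map for f(v). This is the
Yoneda input. -/
theorem evalAt_map {F : B R R'} (p : F.val (RProj.one R)) {V W : RProj R} (f : V ⟶ W)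
    (v : V.obj) : evalAt p W (f.hom.hom v) = F.map f (evalAt p V v) := by
  rw [evalAt, evalAt, ← B.map_comp]
  refine congrArg (fun g : RProj.one R ⟶ W => F.map g p) ?_
  apply ObjectProperty.hom_ext
  apply ModuleCat.hom_ext
  apply LinearMap.ext_ring
  change (1 : R) • f.hom.hom v = f.hom.hom ((1 : R) • v)
  rw [map_smul]

/-- The morphism from the reduced group ring given by an element of `F(R)`. -/
def groupRing.descHom {F : B R R'} (p : F.val (RProj.one R)) : groupRing R R' ⟶ F :=
  lin.descHom (S := (isFGProj R).ι ⋙ forget (ModuleCat.{u} R)) (evalAt p) (evalAt_map p)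

theorem groupRing.descHom_br {F : B R R'} (p : F.val (RProj.one R)) (V : RProj R) (v : V.obj) :
    B.app (groupRing.descHom p) V (br v) = evalAt p V v :=
  lin.descHom_of (S := (isFGProj R).ι ⋙ forget (ModuleCat.{u} R)) (evalAt p) (evalAt_map p) V v

theorem groupRing.app_ext {F : B R R'} {s t : groupRing R R' ⟶ F}
    (h : ∀ V (v : V.obj), B.app s V (br v) = B.app t V (br v)) : s = t :=
  lin.app_ext h

/-- The product `[v] ⊗ [w] ↦ [v ⊗ w]`. -/
def groupRing.mul (V W : RProj R) : (groupRing R R').val V →ₗ[R'] (groupRing R R').val W →ₗ[R']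
    (groupRing R R').val (RProj.tensor V W) :=
  groupRing.desc
    (fun v : V.obj => groupRing.desc
      (fun w : W.obj => br (RProj.tmul v w))
      (by rw [RProj.tmul_zero, br_zero]))
    (groupRing.hom_ext fun w => by
      rw [groupRing.desc_br, LinearMap.zero_apply]
      rw [RProj.zero_tmul, br_zero])

theorem groupRing.mul_br (V W : RProj R) (v : V.obj) (w : W.obj) :
    groupRing.mul V W (br v) (br w) = (br (RProj.tmul v w) :
      (groupRing R R').val (RProj.tensor V W)) := by
  rw [groupRing.mul, groupRing.desc_br, groupRing.desc_br]

theorem groupRing.map_mul {V V' W W' : RProj R} (f : V ⟶ W) (g : V' ⟶ W')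
    (x : (groupRing R R').val V) (y : (groupRing R R').val V') :
    (groupRing R R').map (RProj.tensorMap f g) (groupRing.mul V V' x y) =
      groupRing.mul W W' ((groupRing R R').map f x) ((groupRing R R').map g y) := by
  have key : (groupRing.mul V V').compr₂ ((groupRing R R').map (RProj.tensorMap f g)) =
      (groupRing.mul W W').compl₁₂ ((groupRing R R').map f) ((groupRing R R').map g) := by
    refine groupRing.hom_ext fun v => groupRing.hom_ext fun w => ?_
    rw [LinearMap.compr₂_apply, LinearMap.compl₁₂_apply, groupRing.mul_br, groupRing_map_br,
      groupRing_map_br, groupRing_map_br, groupRing.mul_br, RProj.tensorMap_tmul]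
  exact LinearMap.congr_fun₂ key x y

theorem groupRing.mul_assoc (U V W : RProj R) (x : (groupRing R R').val U)
    (y : (groupRing R R').val V) (z : (groupRing R R').val W) :
    (groupRing R R').map (RProj.assoc U V W) (groupRing.mul _ W (groupRing.mul U V x y) z) =
      groupRing.mul U _ x (groupRing.mul V W y z) := by
  induction x using groupRing.induction with
  | zero => simp
  | add x x' hx hx' => simp only [map_add, LinearMap.add_apply, hx, hx']
  | smul r x hx => simp only [map_smul, LinearMap.smul_apply, hx]
  | br u =>
  induction y using groupRing.induction with
  | zero => simp
  | add x x' hx hx' => simp only [map_add, LinearMap.add_apply, hx, hx']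
  | smul r x hx => simp only [map_smul, LinearMap.smul_apply, hx]
  | br v =>
  induction z using groupRing.induction with
  | zero => simp
  | add x x' hx hx' => simp only [map_add, hx, hx']
  | smul r x hx => simp only [map_smul, hx]
  | br w =>
    rw [groupRing.mul_br, groupRing.mul_br, groupRing.mul_br, groupRing.mul_br, groupRing_map_br,
      RProj.assoc_tmul]

/-- The unit `[1]`. -/
def groupRing.one : (groupRing R R').val (RProj.one R) :=
  br (RProj.unit R)

theorem groupRing.one_mul (V : RProj R) (x : (groupRing R R').val V) :
    (groupRing R R').map (RProj.lid V) (groupRing.mul _ V groupRing.one x) = x := by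
  induction x using groupRing.induction with
  | zero => simp
  | add x x' hx hx' => simp only [map_add, hx, hx']
  | smul r x hx => simp only [map_smul, hx]
  | br v =>
    rw [groupRing.one, groupRing.mul_br, groupRing_map_br, RProj.lid_tmul]

theorem groupRing.mul_one (V : RProj R) (x : (groupRing R R').val V) :
    (groupRing R R').map (RProj.rid V) (groupRing.mul V _ x groupRing.one) = x := by
  induction x using groupRing.induction with
  | zero => simp
  | add x x' hx hx' => simp only [map_add, LinearMap.add_apply, hx, hx']
  | smul r x hx => simp only [map_smul, LinearMap.smul_apply, hx]
  | br v =>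
    rw [groupRing.one, groupRing.mul_br, groupRing_map_br, RProj.rid_tmul]

end GroupRing

/-! ### The multiplicative elementary extension -/

namespace SquareZeroExt

variable {R M R' : Type u} [CommRing R] [CommRing R'] [AddCommGroup M] [Module R M]
  [Module Rᵐᵒᵖ M] (E : SquareZeroExt R M R')

/-- The augmentation `[v] ↦ v`. -/
def grAug : groupRing R R' ⟶ qPushTaut E.q :=
  groupRing.descHom (F := qPushTaut E.q) (1 : R)

theorem grAug_br (V : RProj R) (v : V.obj) : E.augVal E.grAug V (br v) = v :=
  (groupRing.descHom_br (F := qPushTaut E.q) (1 : R) V v).trans (one_smul R v)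

theorem grAug_surjective (V : RProj R) : Function.Surjective (B.app E.grAug V) := fun v =>
  ⟨br (V := V) v, E.grAug_br V v⟩

/-- Bilinearity reduces this to generators. It makes the kernel of the augmentation stable under
products with the group ring on either side. -/
theorem grAug_mul (V W : RProj R) (x : (groupRing R R').val V) (y : (groupRing R R').val W) :
    E.augVal E.grAug (RProj.tensor V W) (groupRing.mul V W x y) =
      RProj.tmul (E.augVal E.grAug V x) (E.augVal E.grAug W y) := by
  induction x using groupRing.induction with
  | zero => simp only [map_zero, LinearMap.zero_apply, RProj.zero_tmul]
  | add x x' hx hx' => simp only [map_add, LinearMap.add_apply, RProj.add_tmul, hx, hx']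
  | smul r x hx => simp only [map_smul, map_smulₛₗ, LinearMap.smul_apply, RProj.smul_tmul, hx]
  | br v =>
  induction y using groupRing.induction with
  | zero => simp only [map_zero, RProj.tmul_zero]
  | add x x' hx hx' => simp only [map_add, RProj.tmul_add, hx, hx']
  | smul r x hx => simp only [map_smul, map_smulₛₗ, RProj.tmul_smul, hx]
  | br w => rw [groupRing.mul_br, grAug_br, grAug_br, grAug_br]

/-- The kernel of the augmentation of the reduced group ring. -/
abbrev grKer : B R R' :=
  B.ker E.grAug

/-- The inclusion of the kernel. -/
abbrev grι (V : RProj R) : E.grKer.val V →ₗ[R'] (groupRing R R').val V :=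
  B.app (B.kerι E.grAug) V

theorem grι_injective (V : RProj R) : Function.Injective (E.grι V) :=
  B.app_kerι_injective E.grAug V

/-- The product of an element of the reduced group ring and an element of the kernel. -/
def mulKerRight (V W : RProj R) :
    (groupRing R R').val V →ₗ[R'] E.grKer.val W →ₗ[R'] E.grKer.val (RProj.tensor V W) :=
  LinearMap.mk₂ R'
    (fun x k => E.kerMk E.grAug _ (groupRing.mul V W x (E.grι W k)) (by
      rw [grAug_mul, augVal_kerι, RProj.tmul_zero]))
    (fun x x' k => E.grι_injective _ (by simp only [map_add, kerι_kerMk, LinearMap.add_apply]))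
    (fun r x k => E.grι_injective _ (by simp only [map_smul, kerι_kerMk, LinearMap.smul_apply]))
    (fun x k k' => E.grι_injective _ (by simp only [map_add, kerι_kerMk]))
    (fun r x k => E.grι_injective _ (by simp only [map_smul, kerι_kerMk]))

/-- The product of an element of the kernel and an element of the reduced group ring. -/
def kerMulRight (V W : RProj R) :
    E.grKer.val V →ₗ[R'] (groupRing R R').val W →ₗ[R'] E.grKer.val (RProj.tensor V W) :=
  LinearMap.mk₂ R'
    (fun k x => E.kerMk E.grAug _ (groupRing.mul V W (E.grι V k) x) (by
      rw [grAug_mul, augVal_kerι, RProj.zero_tmul]))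
    (fun x x' k => E.grι_injective _ (by simp only [map_add, kerι_kerMk, LinearMap.add_apply]))
    (fun r x k => E.grι_injective _ (by simp only [map_smul, kerι_kerMk, LinearMap.smul_apply]))
    (fun x k k' => E.grι_injective _ (by simp only [map_add, kerι_kerMk]))
    (fun r x k => E.grι_injective _ (by simp only [map_smul, kerι_kerMk]))

variable [SMulCommClass Rᵐᵒᵖ R M]

/-- The elementary extension given by the reduced group ring. -/
def grExt : ElemExt R M :=
  E.trunc E.grAug E.grAug_surjective fun _ => inferInstance

/-- The multiplicative structure on the elementary extension given by the reduced group ring. -/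
def grMult : MultStructure E.grExt where
  e := LinearMap.toSpanSingleton R (((qPull E.q).obj (groupRing R R')).val (RProj.one R))
    (qη E.q (groupRing R R') (RProj.one R) groupRing.one)
  m₀₀ V W := pullMul E.q_surjective (groupRing.mul V W)
  m₀₁ V W := pullMul E.q_surjective (E.mulKerRight V W)
  m₁₀ V W := pullMul E.q_surjective (E.kerMulRight V W)
  nat₀₀ f g := pullMul_map _ _ _ f g _ fun x y => groupRing.map_mul f g x y
  -- Identities with values in the kernel are tested after its inclusion in the group ring, where
  -- they are already known.
  nat₀₁ f g := pullMul_map _ _ _ f g _ fun x k => E.grι_injective _ (groupRing.map_mul f g x _)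
  nat₁₀ f g := pullMul_map _ _ _ f g _ fun k x => E.grι_injective _ (groupRing.map_mul f g _ x)
  d_m₀₁ _ _ := pullMul_app_right _ _ _ _ _ fun _ _ => rfl
  d_m₁₀ _ _ := pullMul_app_left _ _ _ _ _ fun _ _ => rfl
  -- For two elements of the kernel, both mixed products are the same group ring product.
  d_m₁₁ _ _ := pullMul_app_balanced _ _ _ _ _ fun _ _ => rfl
  assoc₀₀₀ U V W := pullMul_assoc _ _ _ _ _ _ (groupRing.mul_assoc U V W)
  assoc₁₀₀ U V W := pullMul_assoc _ _ _ _ _ _ fun k y z =>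
    E.grι_injective _ (groupRing.mul_assoc U V W (E.grι U k) y z)
  assoc₀₁₀ U V W := pullMul_assoc _ _ _ _ _ _ fun x k z =>
    E.grι_injective _ (groupRing.mul_assoc U V W x (E.grι V k) z)
  assoc₀₀₁ U V W := pullMul_assoc _ _ _ _ _ _ fun x y k =>
    E.grι_injective _ (groupRing.mul_assoc U V W x y (E.grι W k))
  e_m₀₀ V := pullMul_one_left _ _ _ _ (groupRing.one_mul V)
  e_m₀₁ V := pullMul_one_left _ _ _ _ fun k =>
    E.grι_injective _ (groupRing.one_mul V (E.grι V k))
  m₀₀_e V := pullMul_one_right _ _ _ _ (groupRing.mul_one V)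
  m₁₀_e V := pullMul_one_right _ _ _ _ fun k =>
    E.grι_injective _ (groupRing.mul_one V (E.grι V k))
  a_e r := by
    have h : E.augPullVal E.grAug (RProj.one R)
        (r • qη E.q (groupRing R R') (RProj.one R) groupRing.one) = r • RProj.unit R := by
      rw [map_smul, augPullVal_qη, groupRing.one, grAug_br]
    exact h.trans (mul_one r)
  a_m₀₀ V W x y := by
    obtain ⟨x, rfl⟩ := qη_surjective E.q_surjective (groupRing R R') V x
    obtain ⟨y, rfl⟩ := qη_surjective E.q_surjective (groupRing R R') W y
    change E.augPullVal E.grAug (RProj.tensor V W) (pullMul E.q_surjective (groupRing.mul V W)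
        (qη E.q _ V x) (qη E.q _ W y)) =
      RProj.tmul (E.augPullVal E.grAug V (qη E.q _ V x)) (E.augPullVal E.grAug W (qη E.q _ W y))
    rw [pullMul_qη, augPullVal_qη, augPullVal_qη, augPullVal_qη, grAug_mul]

/-- By Yoneda the reduced group ring maps to the degree 0 term of any resolution compatibly with the
augmentations, so the zigzag is a single map. -/
theorem correspondsTo_grExt : CorrespondsTo E E.grExt := by
  refine ⟨nonempty_projRes _, fun P => ?_⟩
  have := P.projective 0
  have hflat : ∀ V, Module.Flat R' ((P.P.X 0).val V) := fun V =>
    have := projective_val (P.P.X 0) V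
    inferInstance
  refine ⟨E.trunc P.aug P.aug_surjective hflat, ⟨E.truncationIso P hflat⟩, ?_⟩
  -- The augmentation of the group ring corresponds to 1 ∈ R, so a map over `q_*(I)` is exactly a
  -- lift p of 1.
  obtain ⟨p, hp⟩ := P.aug_surjective (RProj.one R) (1 : R)
  refine Zigzag.of_hom <| E.truncMap E.grAug E.grAug_surjective (groupRing.descHom p)
    (groupRing.app_ext fun V v => ?_)
  rw [B.app_comp, groupRing.descHom_br, evalAt, B.app_map, hp]
  exact (groupRing.descHom_br (F := qPushTaut E.q) (1 : R) V v).symm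

end SquareZeroExt

end

end MacLane

theorem mainTheorem7 {R M R' : Type u} [CommRing R] [CommRing R'] [AddCommGroup M]
    [Module R M] [Module Rᵐᵒᵖ M] [SMulCommClass Rᵐᵒᵖ R M]
    (E : MacLane.SquareZeroExt R M R') :
    (∀ (r : R) (m : M), MulOpposite.op r • m = r • m) ∧
    ∃ φ : MacLane.ElemExt R M,
      Nonempty (MacLane.MultStructure φ) ∧ MacLane.CorrespondsTo E φ :=
  ⟨MacLane.SquareZeroExt.op_smul E, E.grExt, ⟨E.grMult⟩, E.correspondsTo_grExt⟩
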